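/- **Theorem 2.2.** Let $N\ge 1$, $R>0$, $a,b\ge 0$, $p>0$, and let $h\in C^1[0,\infty)$ be nondecreasing with $h(t)>0$ for all $t>0$. Put $H(t)=\int_0^t h(k)\,dk$, and let $B_R$ be the open ball of radius $R$ centred at the origin of $\mathbb R^N$. A positive radial solution in $B_R$ means a pair $(u,v)$ of positive radially symmetric functions in $C^2(B_R)$ with $$\Delta u=|x|^a v^p,\qquad \Delta v=|x|^b h(|\nabla u|)\qquad\text{in } B_R .$$ Suppose that there is a positive radial solution $(u,v)$ in $B_R$. Then: (i) every positive radial solution in $B_R$ has both components bounded in $B_R$ if and only if $$\int_1^\infty \frac{ds}{\big(\int_0^s H(t)\,dt\big)^{p/(2p+1)}}=\infty ;$$ (ii) there is a positive radial solution $(u_1,v_1)$ in $B_R$ with $u_1$ bounded in $B_R$ and $\lim_{|x|\nearrow R}v_1(x)=\infty$ if and only if $$\int_1^\infty \frac{s\,ds}{\big(\int_0^s H(t)\,dt\big)^{p/(2p+1)}}<\infty ;$$ (iii) there is a positive radial solution $(u_1,v_1)$ in $B_R$ with $\lim_{|x|\nearrow R}u_1(x)=\lim_{|x|\nearrow R}v_1(x)=\infty$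 if and only if $$\int_1^\infty \frac{ds}{\big(\int_0^s H(t)\,dt\big)^{p/(2p+1)}}<\infty\quad\text{and}\quad \int_1^\infty \frac{s\,ds}{\big(\int_0^s H(t)\,dt\big)^{p/(2p+1)}}=\infty .$$ Moreover, if $u$ and $v$ are not both bounded in $B_R$, then for this given solution: $u$ is bounded and $\lim_{|x|\nearrow R}v(x)=\infty$ if and only if the condition in (ii) holds; and $\lim_{|x|\nearrow R}u(x)=\lim_{|x|\nearrow R}v(x)=\infty$ if and only if the condition in (iii) holds. -/

import Mathlib

open Set Filter Topology MeasureTheory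

noncomputable section

namespace RadialSystem

/-- The open ball `B_R` of radius `R` centred at the origin of `ℝ^N`. -/
abbrev B (N : ℕ) (R : ℝ) : Set (EuclideanSpace ℝ (Fin N)) :=
  Metric.ball 0 R

/-- `(u, v)` is a positive radial (classical) solution in `B_R` of the system
`Δu = |x|^a v^p`, `Δv = |x|^b h(|∇u|)`. -/
structure IsPositiveRadialSolution (N : ℕ) (R a b p : ℝ) (h : ℝ → ℝ)
    (u v : EuclideanSpace ℝ (Fin N) → ℝ) : Prop where
  contDiffOn_u : ContDiffOn ℝ 2 u (B N R)
  contDiffOn_v : ContDiffOn ℝ 2 v (B N R)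
  pos_u : ∀ x ∈ B N R, 0 < u x
  pos_v : ∀ x ∈ B N R, 0 < v x
  radial_u : ∀ x ∈ B N R, ∀ y ∈ B N R, ‖x‖ = ‖y‖ → u x = u y
  radial_v : ∀ x ∈ B N R, ∀ y ∈ B N R, ‖x‖ = ‖y‖ → v x = v y
  eq_u : ∀ x ∈ B N R, Laplacian.laplacian u x = ‖x‖ ^ a * v x ^ p
  eq_v : ∀ x ∈ B N R, Laplacian.laplacian v x = ‖x‖ ^ b * h ‖gradient u x‖

/-- `w` is bounded in `B_R`. -/
def BoundedIn (N : ℕ) (R : ℝ) (w : EuclideanSpace ℝ (Fin N) → ℝ) : Prop :=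
  ∃ M : ℝ, ∀ x ∈ B N R, |w x| ≤ M

/-- `w(x) → ∞` as `|x| ↗ R`. -/
def BlowsUp (N : ℕ) (R : ℝ) (w : EuclideanSpace ℝ (Fin N) → ℝ) : Prop :=
  Tendsto w (comap (fun x => ‖x‖) (𝓝[<] R)) atTop

/-- `H(t) = ∫₀ᵗ h(k) dk`. -/
def H (h : ℝ → ℝ) (t : ℝ) : ℝ := ∫ k in (0 : ℝ)..t, h k

/-- `(∫₀ˢ H(t) dt)^{p/(2p+1)}`. -/
def denom (p : ℝ) (h : ℝ → ℝ) (s : ℝ) : ℝ :=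
  (∫ t in (0 : ℝ)..s, H h t) ^ (p / (2 * p + 1))

/-- `∫₁^∞ ds / (∫₀ˢ H(t) dt)^{p/(2p+1)}`, as a value in `[0, ∞]`. -/
def I₀ (p : ℝ) (h : ℝ → ℝ) : ENNReal :=
  ∫⁻ s in Ioi (1 : ℝ), ENNReal.ofReal (1 / denom p h s)

/-- `∫₁^∞ s ds / (∫₀ˢ H(t) dt)^{p/(2p+1)}`, as a value in `[0, ∞]`. -/
def I₁ (p : ℝ) (h : ℝ → ℝ) : ENNReal :=
  ∫⁻ s in Ioi (1 : ℝ), ENNReal.ofReal (s / denom p h s)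

end RadialSystem

end

/-! Write N = n + 1, w = u' for the radial derivative, and E(s) = ∫₀ˢ H. The system reads (rⁿ w)' =
rⁿ r^a v^p, (rⁿ v')' = rⁿ r^b h(w). The functions r^a v^p and r^b h(w) are nondecreasing, so w' lies
between r^a v^p / (n + 1) and r^a v^p, and v'' between the same multiples of r^b h(w)
(`mul_avg_deriv_bounds`). Away from r = 0 the system is thus comparable to w' = v^p, v'' = h(w).

For the comparison system, (v' v^p)' is comparable to h(w) w', so v' v^p is comparable to H(w); a
further factor v^p gives v^(2p+1) comparable to E(w), whence w' is comparable to E(w)^(p/(2p+1)).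
The extra term p v^(p-1) v'² is dropped in the lower bound and controlled in the upper one by v'² ≤
2 R^b h(w) v. The precise forms are `exists_deriv_slope_le` and `exists_le_deriv_slope`; the latter
is shifted so that its constant is the same for all solutions.

Dividing by the power of E, the primitive Φ₀ of 1 / E^(p/(2p+1)) satisfies (Φ₀(w))' ≈ 1, and Φ₁,
with the extra factor s, satisfies (Φ₁(w))' ≈ w = u'. If v is unbounded, so is w, which forces `I₀`
to be finite because R is; then u is bounded exactly when `I₁` is finite. Both components are
nondecreasing in r, so unbounded means blow-up, and v bounded implies u bounded.

What remains is an unbounded solution when `I₀` is finite (`exists_unbounded_profile`). If the given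
solution is bounded, raising its initial value produces solutions with arbitrarily large finite
values at R. Finiteness of `I₀` bounds all solutions uniformly on compact subintervals of [0, R), so
the initial values accumulate. The limit solution lives on [0, R), and by continuous dependence it
cannot be bounded. -/

namespace RadialSystem

/-! ### Weighted averages and radial potentials on the line -/

/-- The weighted average `∫₀¹ σⁿ f(rσ) dσ = r^{-n-1} ∫₀ʳ tⁿ f(t) dt`. -/
noncomputable def avg (n : ℕ) (f : ℝ → ℝ) (r : ℝ) : ℝ := ∫ σ in (0 : ℝ)..1, σ ^ n * f (r * σ)

/-- The radial Newtonian potential: `Δ (newt n f ‖x‖) = f ‖x‖` in dimension `n + 1`. -/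
noncomputable def newt (n : ℕ) (f : ℝ → ℝ) (r : ℝ) : ℝ := ∫ s in (0 : ℝ)..r, s * avg n f s

/-- The function `f` frozen outside `[0, ρ]`. -/
noncomputable def clampTo (ρ : ℝ) (f : ℝ → ℝ) (t : ℝ) : ℝ := f (max 0 (min ρ t))

lemma clampTo_eq {ρ t : ℝ} (f : ℝ → ℝ) (h0 : 0 ≤ t) (h1 : t ≤ ρ) : clampTo ρ f t = f t := by
  simp [clampTo, h0, h1]

lemma clampTo_mem {ρ : ℝ} (hρ : 0 ≤ ρ) (t : ℝ) : max 0 (min ρ t) ∈ Icc 0 ρ :=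
  ⟨le_max_left _ _, max_le hρ (min_le_left _ _)⟩

lemma continuous_clampTo {ρ : ℝ} (hρ : 0 ≤ ρ) {f : ℝ → ℝ} (hf : ContinuousOn f (Icc 0 ρ)) :
    Continuous (clampTo ρ f) :=
  hf.comp_continuous (by fun_prop) (clampTo_mem hρ)

lemma mul_mem_Icc_of_unit {r σ : ℝ} (hr : 0 ≤ r) (hσ : σ ∈ Icc (0 : ℝ) 1) : r * σ ∈ Icc 0 r :=
  ⟨mul_nonneg hr hσ.1, mul_le_of_le_one_right hr hσ.2⟩

lemma avg_congr (n : ℕ) {f g : ℝ → ℝ} {r : ℝ} (hr : 0 ≤ r) (hfg : EqOn f g (Icc 0 r)) :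
    avg n f r = avg n g r := by
  refine intervalIntegral.integral_congr fun σ hσ => ?_
  rw [uIcc_of_le zero_le_one] at hσ
  simp only [hfg (mul_mem_Icc_of_unit hr hσ)]

lemma newt_congr (n : ℕ) {f g : ℝ → ℝ} {r : ℝ} (hr : 0 ≤ r) (hfg : EqOn f g (Icc 0 r)) :
    newt n f r = newt n g r := by
  refine intervalIntegral.integral_congr fun s hs => ?_
  rw [uIcc_of_le hr] at hs
  simp only [avg_congr n hs.1 (hfg.mono (Icc_subset_Icc_right hs.2))]

lemma continuous_avg (n : ℕ) {f : ℝ → ℝ} (hf : Continuous f) : Continuous (avg n f) :=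
  intervalIntegral.continuous_parametric_intervalIntegral_of_continuous' (by fun_prop) _ _

lemma hasDerivAt_newt (n : ℕ) {f : ℝ → ℝ} (hf : Continuous f) (r : ℝ) :
    HasDerivAt (newt n f) (r * avg n f r) r := by
  have hc : Continuous fun s => s * avg n f s := continuous_id.mul (continuous_avg n hf)
  exact intervalIntegral.integral_hasDerivAt_right (hc.intervalIntegrable _ _)
    (hc.stronglyMeasurableAtFilter _ _) hc.continuousAt

lemma continuous_newt (n : ℕ) {f : ℝ → ℝ} (hf : Continuous f) : Continuous (newt n f) :=
  continuous_iff_continuousAt.2 fun r => (hasDerivAt_newt n hf r).continuousAt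

lemma newt_zero (n : ℕ) (f : ℝ → ℝ) : newt n f 0 = 0 := by simp [newt]

lemma avg_zero (n : ℕ) (f : ℝ → ℝ) : avg n f 0 = f 0 / (n + 1) := by
  simp only [avg, zero_mul, intervalIntegral.integral_mul_const, integral_pow]
  simp; ring

/-- Substitution t = rσ. The integral over the unit interval is preferred as the definition because
it has no singularity at r = 0. -/
lemma pow_mul_avg (n : ℕ) (f : ℝ → ℝ) (r : ℝ) :
    r ^ (n + 1) * avg n f r = ∫ t in (0 : ℝ)..r, t ^ n * f t := by
  have h := intervalIntegral.smul_integral_comp_mul_left (a := 0) (b := 1)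
    (fun t => t ^ n * f t) r
  simp only [mul_zero, mul_one, smul_eq_mul] at h
  rw [← h, avg, pow_succ', mul_assoc, ← intervalIntegral.integral_const_mul]
  congr 2
  ext σ
  ring

lemma hasDerivAt_avg (n : ℕ) {f : ℝ → ℝ} (hf : Continuous f) {r : ℝ} (hr : 0 < r) :
    HasDerivAt (avg n f) ((f r - (n + 1) * avg n f r) / r) r := by
  have hc : Continuous fun t => t ^ n * f t := by fun_prop
  have h1 : HasDerivAt (fun r => ∫ t in (0 : ℝ)..r, t ^ n * f t) (r ^ n * f r) r :=
    intervalIntegral.integral_hasDerivAt_right (hc.intervalIntegrable _ _)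
      (hc.stronglyMeasurableAtFilter _ _) hc.continuousAt
  have h2 := h1.div (hasDerivAt_pow (n + 1) r) (by positivity)
  have h3 : avg n f =ᶠ[𝓝 r]
      (fun r => ∫ t in (0 : ℝ)..r, t ^ n * f t) / (fun r => r ^ (n + 1)) := by
    filter_upwards [lt_mem_nhds hr] with s hs
    rw [Pi.div_apply, ← pow_mul_avg n f s, mul_div_cancel_left₀ _ (by positivity)]
  refine (h2.congr_of_eventuallyEq h3).congr_deriv ?_
  rw [← pow_mul_avg n f r]
  simp only [add_tsub_cancel_right]
  push_cast
  field_simp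
  ring

/-- This is the radial equation φ'' + (n/r) φ' = f for φ' = r · avg. -/
lemma hasDerivAt_mul_avg (n : ℕ) {f : ℝ → ℝ} (hf : Continuous f) {r : ℝ} (hr : 0 < r) :
    HasDerivAt (fun s => s * avg n f s) (f r - n * avg n f r) r := by
  refine ((hasDerivAt_id r).mul (hasDerivAt_avg n hf hr)).congr_deriv ?_
  simp only [id]
  field_simp
  ring

/-! ### Averages and potentials of functions given only on [0, R) -/

section Half

variable (n : ℕ) {f g : ℝ → ℝ} {r R : ℝ}

/-- The average and the potential at s only see f on [0, s], so near r < ρ the function f may be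
replaced by its continuous extension frozen beyond ρ. This reduces each local statement on [0, R) to
the global one. -/
lemma clampTo_eventuallyEq {ρ : ℝ} (h0 : 0 < r) (h1 : r < ρ) :
    ∀ᶠ s in 𝓝 r, 0 ≤ s ∧ EqOn f (clampTo ρ f) (Icc 0 s) := by
  filter_upwards [lt_mem_nhds h0, gt_mem_nhds h1] with s hs hs'
  exact ⟨hs.le, fun t ht => (clampTo_eq f ht.1 (ht.2.trans hs'.le)).symm⟩

lemma continuousOn_avg (hf : ContinuousOn f (Ico 0 R)) : ContinuousOn (avg n f) (Ico 0 R) := by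
  intro r hr
  obtain ⟨ρ, h1, h2⟩ := exists_between hr.2
  have hc := continuous_clampTo (hr.1.trans h1.le) (hf.mono fun t ht => ⟨ht.1, ht.2.trans_lt h2⟩)
  refine (continuous_avg n hc).continuousWithinAt.congr_of_eventuallyEq ?_ ?_
  · filter_upwards [self_mem_nhdsWithin, nhdsWithin_le_nhds (gt_mem_nhds h1)] with s hs hs'
    exact avg_congr n hs.1 fun t ht => (clampTo_eq f ht.1 (ht.2.trans hs'.le)).symm
  · exact avg_congr n hr.1 fun t ht => (clampTo_eq f ht.1 (ht.2.trans h1.le)).symm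

lemma continuousOn_newt (hf : ContinuousOn f (Ico 0 R)) : ContinuousOn (newt n f) (Ico 0 R) := by
  intro r hr
  obtain ⟨ρ, h1, h2⟩ := exists_between hr.2
  have hc := continuous_clampTo (hr.1.trans h1.le) (hf.mono fun t ht => ⟨ht.1, ht.2.trans_lt h2⟩)
  refine (continuous_newt n hc).continuousWithinAt.congr_of_eventuallyEq ?_ ?_
  · filter_upwards [self_mem_nhdsWithin, nhdsWithin_le_nhds (gt_mem_nhds h1)] with s hs hs'
    exact newt_congr n hs.1 fun t ht => (clampTo_eq f ht.1 (ht.2.trans hs'.le)).symm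
  · exact newt_congr n hr.1 fun t ht => (clampTo_eq f ht.1 (ht.2.trans h1.le)).symm

lemma hasDerivAt_mul_avg_of_continuousOn (hf : ContinuousOn f (Ico 0 R)) (hr : r ∈ Ioo 0 R) :
    HasDerivAt (fun s => s * avg n f s) (f r - n * avg n f r) r := by
  obtain ⟨ρ, h1, h2⟩ := exists_between hr.2
  have hc := continuous_clampTo (hr.1.le.trans h1.le)
    (hf.mono fun t ht => ⟨ht.1, ht.2.trans_lt h2⟩)
  have he := clampTo_eventuallyEq (f := f) hr.1 h1
  have hs := he.self_of_nhds
  rw [avg_congr n hs.1 hs.2, hs.2 ⟨hs.1, le_rfl⟩]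
  refine (hasDerivAt_mul_avg n hc hr.1).congr_of_eventuallyEq ?_
  filter_upwards [he] with s hs
  rw [avg_congr n hs.1 hs.2]

lemma hasDerivAt_newt_of_continuousOn (hf : ContinuousOn f (Ico 0 R)) (hr : r ∈ Ioo 0 R) :
    HasDerivAt (newt n f) (r * avg n f r) r := by
  obtain ⟨ρ, h1, h2⟩ := exists_between hr.2
  have hc := continuous_clampTo (hr.1.le.trans h1.le)
    (hf.mono fun t ht => ⟨ht.1, ht.2.trans_lt h2⟩)
  have he := clampTo_eventuallyEq (f := f) hr.1 h1
  have hs := he.self_of_nhds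
  rw [avg_congr n hs.1 hs.2]
  refine (hasDerivAt_newt n hc r).congr_of_eventuallyEq ?_
  filter_upwards [he] with s hs
  rw [newt_congr n hs.1 hs.2]

lemma intervalIntegrable_avg (hr : 0 ≤ r) (hf : ContinuousOn f (Icc 0 r)) :
    IntervalIntegrable (fun σ => σ ^ n * f (r * σ)) volume 0 1 := by
  refine ContinuousOn.intervalIntegrable ?_
  rw [uIcc_of_le zero_le_one]
  exact (continuousOn_id.pow n).mul
    (hf.comp (continuousOn_const.mul continuousOn_id) fun σ hσ => mul_mem_Icc_of_unit hr hσ)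

lemma avg_le_avg (hr : 0 ≤ r) (hf : ContinuousOn f (Icc 0 r)) (hg : ContinuousOn g (Icc 0 r))
    (hfg : ∀ t ∈ Icc 0 r, f t ≤ g t) : avg n f r ≤ avg n g r := by
  refine intervalIntegral.integral_mono_on zero_le_one (intervalIntegrable_avg n hr hf)
    (intervalIntegrable_avg n hr hg) fun σ hσ => ?_
  exact mul_le_mul_of_nonneg_left (hfg _ (mul_mem_Icc_of_unit hr hσ)) (pow_nonneg hσ.1 n)

lemma avg_nonneg (hr : 0 ≤ r) (hf : ∀ t ∈ Icc 0 r, 0 ≤ f t) : 0 ≤ avg n f r :=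
  intervalIntegral.integral_nonneg zero_le_one fun _ hσ =>
    mul_nonneg (pow_nonneg hσ.1 n) (hf _ (mul_mem_Icc_of_unit hr hσ))

lemma avg_const (c : ℝ) (r : ℝ) : avg n (fun _ => c) r = c / (n + 1) := by
  simp only [avg, intervalIntegral.integral_mul_const, integral_pow]
  simp; ring

lemma avg_le_of_le {M : ℝ} (hr : 0 ≤ r) (hf : ContinuousOn f (Icc 0 r))
    (hM : ∀ t ∈ Icc 0 r, f t ≤ M) : (n + 1) * avg n f r ≤ M := by
  have h := avg_le_avg n hr hf continuousOn_const hM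
  rw [avg_const] at h
  rwa [le_div_iff₀ (by positivity), mul_comm] at h

lemma avg_mono {s : ℝ} (hs : 0 ≤ s) (hsr : s ≤ r) (hf : ContinuousOn f (Icc 0 r))
    (hm : MonotoneOn f (Icc 0 r)) : avg n f s ≤ avg n f r := by
  have hr := hs.trans hsr
  refine intervalIntegral.integral_mono_on zero_le_one
    (intervalIntegrable_avg n hs (hf.mono (Icc_subset_Icc_right hsr)))
    (intervalIntegrable_avg n hr hf) fun σ hσ => ?_
  refine mul_le_mul_of_nonneg_left (hm ?_ (mul_mem_Icc_of_unit hr hσ)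
    (mul_le_mul_of_nonneg_right hsr hσ.1)) (pow_nonneg hσ.1 n)
  exact Icc_subset_Icc_right hsr (mul_mem_Icc_of_unit hs hσ)

end Half

/-! ### The radial potential in Euclidean space -/

section Potential

open scoped RealInnerProductSpace

lemma hasFDerivAt_norm_of_ne_zero {E : Type*} [NormedAddCommGroup E] [InnerProductSpace ℝ E]
    {x : E} (hx : x ≠ 0) : HasFDerivAt (fun y : E => ‖y‖) (‖x‖⁻¹ • innerSL ℝ x) x := by
  have h := ((hasStrictFDerivAt_norm_sq x).hasFDerivAt).sqrt (by positivity)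
  simp only [Real.sqrt_sq (norm_nonneg _)] at h
  refine h.congr_fderiv ?_
  ext y
  have := norm_pos_iff.2 hx
  simp
  field_simp

variable (n : ℕ) {f : ℝ → ℝ}

/-- Away from the origin this is the chain rule. At the origin the norm is not differentiable, but
the potential has zero derivative there, so it is o(‖y‖). -/
lemma hasFDerivAt_newt_norm (hf : Continuous f) (x : EuclideanSpace ℝ (Fin (n + 1))) :
    HasFDerivAt (fun y : EuclideanSpace ℝ (Fin (n + 1)) => newt n f ‖y‖)
      (innerSL ℝ (avg n f ‖x‖ • x)) x := by
  rcases eq_or_ne x 0 with rfl | hx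
  · have h0 := hasDerivAt_newt n hf 0
    rw [zero_mul, hasDerivAt_iff_isLittleO_nhds_zero] at h0
    rw [hasFDerivAt_iff_isLittleO_nhds_zero]
    have ht : Tendsto (fun y : EuclideanSpace ℝ (Fin (n + 1)) => ‖y‖) (𝓝 0) (𝓝 0) :=
      tendsto_norm_zero
    have h1 := h0.comp_tendsto ht
    refine Asymptotics.IsLittleO.of_norm_right ?_
    simpa [Function.comp_def] using h1
  · have h1 := (hasDerivAt_newt n hf ‖x‖).comp_hasFDerivAt x (hasFDerivAt_norm_of_ne_zero hx)
    refine h1.congr_fderiv ?_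
    ext y
    have := norm_pos_iff.2 hx
    simp
    field_simp

/-- The derivative of the vector field `x ↦ avg n f ‖x‖ • x`. -/
noncomputable def fieldDeriv (f : ℝ → ℝ) (x : EuclideanSpace ℝ (Fin (n + 1))) :
    EuclideanSpace ℝ (Fin (n + 1)) →L[ℝ] EuclideanSpace ℝ (Fin (n + 1)) :=
  avg n f ‖x‖ • ContinuousLinearMap.id ℝ _ +
    ((f ‖x‖ - (n + 1) * avg n f ‖x‖) / ‖x‖ ^ 2) • (innerSL ℝ x).smulRight x

lemma hasFDerivAt_field (hf : Continuous f) (x : EuclideanSpace ℝ (Fin (n + 1))) :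
    HasFDerivAt (fun y : EuclideanSpace ℝ (Fin (n + 1)) => avg n f ‖y‖ • y)
      (fieldDeriv n f x) x := by
  rcases eq_or_ne x 0 with rfl | hx
  · rw [hasFDerivAt_iff_isLittleO_nhds_zero]
    have hc : Tendsto (fun y : EuclideanSpace ℝ (Fin (n + 1)) => avg n f ‖y‖ - avg n f 0)
        (𝓝 0) (𝓝 0) := by
      have : Continuous fun y : EuclideanSpace ℝ (Fin (n + 1)) => avg n f ‖y‖ - avg n f 0 :=
        ((continuous_avg n hf).comp continuous_norm).sub continuous_const
      simpa using this.tendsto 0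
    -- At the origin the remainder is (avg ‖y‖ - avg 0) • y, an o(1) factor times y.
    have h1 := ((Asymptotics.isLittleO_one_iff ℝ).2 hc).smul_isBigO
      (Asymptotics.isBigO_refl (fun y : EuclideanSpace ℝ (Fin (n + 1)) => y) (𝓝 0))
    simpa [fieldDeriv, sub_smul] using h1
  · have hx' := norm_pos_iff.2 hx
    have h1 := ((hasDerivAt_avg n hf hx').comp_hasFDerivAt x
      (hasFDerivAt_norm_of_ne_zero hx)).smul (hasFDerivAt_id x)
    refine h1.congr_fderiv ?_
    ext y i
    simp [fieldDeriv]
    field_simp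

/-- The only doubtful point is the origin. The rank-one term has norm at most |f - (n + 1) avg|,
which tends to 0 because avg 0 = f 0 / (n + 1). Hence the potential is C² although f is merely
continuous. -/
lemma continuous_fieldDeriv (hf : Continuous f) : Continuous (fieldDeriv n f) := by
  have ha : Continuous fun y : EuclideanSpace ℝ (Fin (n + 1)) => avg n f ‖y‖ :=
    (continuous_avg n hf).comp continuous_norm
  have hk : Continuous fun y : EuclideanSpace ℝ (Fin (n + 1)) =>
      f ‖y‖ - (n + 1) * avg n f ‖y‖ := (hf.comp continuous_norm).sub (continuous_const.mul ha)
  have ht : Continuous fun y : EuclideanSpace ℝ (Fin (n + 1)) =>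
      (innerSL ℝ y).smulRight y :=
    (ContinuousLinearMap.smulRightL ℝ (EuclideanSpace ℝ (Fin (n + 1)))
      (EuclideanSpace ℝ (Fin (n + 1)))).continuous₂.comp
      (((innerSL ℝ).continuous).prodMk continuous_id)
  refine (ha.smul continuous_const).add (continuous_iff_continuousAt.2 fun x => ?_)
  rcases eq_or_ne x 0 with rfl | hx
  · have h0 : f 0 - (n + 1) * avg n f 0 = 0 := by
      rw [avg_zero]; field_simp; ring
    have h1 := hk.norm.tendsto 0
    simp only [norm_zero, h0] at h1
    simp only [ContinuousAt, norm_zero, h0, zero_div, zero_smul]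
    refine squeeze_zero_norm (fun y => ?_) h1
    rw [norm_smul, ContinuousLinearMap.norm_smulRight_apply, innerSL_apply_norm, norm_div,
      norm_pow, norm_norm, ← sq]
    rw [div_mul_eq_mul_div]
    exact div_le_of_le_mul₀ (by positivity) (by positivity) le_rfl
  · exact ((hk.continuousAt.div (by fun_prop) (by positivity))).smul ht.continuousAt

lemma contDiff_newt_norm (hf : Continuous f) :
    ContDiff ℝ 2 (fun y : EuclideanSpace ℝ (Fin (n + 1)) => newt n f ‖y‖) := by
  have h1 : ContDiff ℝ 1 (fun y : EuclideanSpace ℝ (Fin (n + 1)) => avg n f ‖y‖ • y) :=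
    contDiff_one_iff_hasFDerivAt.2 ⟨_, continuous_fieldDeriv n hf, hasFDerivAt_field n hf⟩
  have h2 : (2 : WithTop ℕ∞) = ((1 : ℕ) : WithTop ℕ∞) + 1 := by norm_num
  rw [h2, contDiff_succ_iff_hasFDerivAt]
  exact ⟨_, (innerSL ℝ).contDiff.comp h1, hasFDerivAt_newt_norm n hf⟩

lemma gradient_newt_norm (hf : Continuous f) (x : EuclideanSpace ℝ (Fin (n + 1))) :
    gradient (fun y : EuclideanSpace ℝ (Fin (n + 1)) => newt n f ‖y‖) x = avg n f ‖x‖ • x := by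
  refine HasGradientAt.gradient ?_
  rw [hasGradientAt_iff_hasFDerivAt]
  exact hasFDerivAt_newt_norm n hf x

lemma laplacian_newt_norm (hf : Continuous f) (x : EuclideanSpace ℝ (Fin (n + 1))) :
    Laplacian.laplacian (fun y : EuclideanSpace ℝ (Fin (n + 1)) => newt n f ‖y‖) x =
      f ‖x‖ := by
  rw [InnerProductSpace.laplacian_eq_iteratedFDeriv_orthonormalBasis _
    (EuclideanSpace.basisFun (Fin (n + 1)) ℝ)]
  have h1 : fderiv ℝ (fun y : EuclideanSpace ℝ (Fin (n + 1)) => newt n f ‖y‖) =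
      fun y => innerSL ℝ (avg n f ‖y‖ • y) :=
    funext fun y => (hasFDerivAt_newt_norm n hf y).fderiv
  have h2 : fderiv ℝ (fun y => innerSL ℝ (avg n f ‖y‖ • y)) x =
      (innerSL ℝ).comp (fieldDeriv n f x) :=
    ((innerSL ℝ).hasFDerivAt.comp x (hasFDerivAt_field n hf x)).fderiv
  simp only [iteratedFDeriv_two_apply, h1, h2]
  -- Diagonal entries of the Hessian; their sum is (n + 1) avg + (f - (n + 1) avg) = f.
  have h3 : ∀ i : Fin (n + 1), ⟪fieldDeriv n f x (EuclideanSpace.basisFun (Fin (n + 1)) ℝ i),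
      EuclideanSpace.basisFun (Fin (n + 1)) ℝ i⟫ = avg n f ‖x‖ +
      ((f ‖x‖ - (n + 1) * avg n f ‖x‖) / ‖x‖ ^ 2) * x i ^ 2 := by
    intro i
    simp [fieldDeriv, inner_add_left, inner_smul_left, EuclideanSpace.inner_single_right]
    ring_nf
    simp
  have h4 : ∑ i, x i ^ 2 = ‖x‖ ^ 2 := by rw [EuclideanSpace.norm_sq_eq]; simp
  simp only [Matrix.cons_val_zero, Matrix.cons_val_one, ContinuousLinearMap.comp_apply,
    innerSL_apply_apply, h3, Finset.sum_add_distrib, ← Finset.mul_sum, h4]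
  rcases eq_or_ne x 0 with rfl | hx
  · simp [avg_zero]; field_simp
  · have := norm_pos_iff.2 hx
    simp
    field_simp
    ring

end Potential

lemma eq_of_hasDerivAt_zero {g : ℝ → ℝ} {R r : ℝ} (hg : ContinuousOn g (Ico 0 R))
    (hd : ∀ s ∈ Ioo 0 R, HasDerivAt g 0 s) (hr : r ∈ Ico 0 R) : g r = g 0 := by
  rcases hr.1.eq_or_lt with rfl | h0
  · rfl
  obtain ⟨c, -, h⟩ := exists_hasDerivAt_eq_slope g (fun _ => 0) h0
    (hg.mono fun s hs => ⟨hs.1, hs.2.trans_lt hr.2⟩)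
    fun s hs => hd s ⟨hs.1, hs.2.trans hr.2⟩
  have : r - 0 ≠ 0 := by simpa using h0.ne'
  field_simp at h
  linarith

/-! ### The potential in the ball for a density on [0, R) -/

section Local

variable (n : ℕ) {f : ℝ → ℝ} {R : ℝ}

lemma exists_clampTo_eventuallyEq (hf : ContinuousOn f (Ico 0 R))
    {x : EuclideanSpace ℝ (Fin (n + 1))} (hx : x ∈ B (n + 1) R) :
    ∃ g : ℝ → ℝ, Continuous g ∧ g ‖x‖ = f ‖x‖ ∧ avg n g ‖x‖ = avg n f ‖x‖ ∧
      (fun y : EuclideanSpace ℝ (Fin (n + 1)) => newt n f ‖y‖) =ᶠ[𝓝 x]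
        fun y => newt n g ‖y‖ := by
  have hxR : ‖x‖ < R := by simpa using hx
  obtain ⟨ρ, h1, h2⟩ := exists_between hxR
  refine ⟨clampTo ρ f, continuous_clampTo ((norm_nonneg x).trans h1.le)
    (hf.mono fun t ht => ⟨ht.1, ht.2.trans_lt h2⟩), clampTo_eq f (norm_nonneg x) h1.le,
    avg_congr n (norm_nonneg x) fun t ht => clampTo_eq f ht.1 (ht.2.trans h1.le), ?_⟩
  filter_upwards [continuous_norm.continuousAt.eventually (gt_mem_nhds h1)] with y hy
  exact newt_congr n (norm_nonneg y) fun t ht =>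
    (clampTo_eq f ht.1 (ht.2.trans (le_of_lt hy))).symm

lemma contDiffOn_newt_norm (hf : ContinuousOn f (Ico 0 R)) :
    ContDiffOn ℝ 2 (fun y : EuclideanSpace ℝ (Fin (n + 1)) => newt n f ‖y‖) (B (n + 1) R) := by
  intro x hx
  obtain ⟨g, hg, -, -, he⟩ := exists_clampTo_eventuallyEq n hf hx
  exact ((contDiff_newt_norm n hg).contDiffAt.congr_of_eventuallyEq he).contDiffWithinAt

lemma gradient_newt_norm_of_continuousOn (hf : ContinuousOn f (Ico 0 R))
    {x : EuclideanSpace ℝ (Fin (n + 1))} (hx : x ∈ B (n + 1) R) :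
    gradient (fun y : EuclideanSpace ℝ (Fin (n + 1)) => newt n f ‖y‖) x = avg n f ‖x‖ • x := by
  obtain ⟨g, hg, -, ha, he⟩ := exists_clampTo_eventuallyEq n hf hx
  rw [he.gradient_eq, gradient_newt_norm n hg, ha]

lemma laplacian_newt_norm_of_continuousOn (hf : ContinuousOn f (Ico 0 R))
    {x : EuclideanSpace ℝ (Fin (n + 1))} (hx : x ∈ B (n + 1) R) :
    Laplacian.laplacian (fun y : EuclideanSpace ℝ (Fin (n + 1)) => newt n f ‖y‖) x =
      f ‖x‖ := by
  obtain ⟨g, hg, h0, -, he⟩ := exists_clampTo_eventuallyEq n hf hx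
  rw [(InnerProductSpace.laplacian_congr_nhds he).self_of_nhds, laplacian_newt_norm n hg, h0]

end Local

/-! ### Radial solutions of the Poisson equation are potentials -/

section Forward

variable {n : ℕ} {R : ℝ} {u : EuclideanSpace ℝ (Fin (n + 1)) → ℝ}

lemma hasFDerivAt_of_contDiffOn (hu : ContDiffOn ℝ 2 u (B (n + 1) R))
    {x : EuclideanSpace ℝ (Fin (n + 1))} (hx : x ∈ B (n + 1) R) :
    HasFDerivAt u (fderiv ℝ u x) x :=
  ((hu.contDiffAt (Metric.isOpen_ball.mem_nhds hx)).differentiableAt (by norm_num)).hasFDerivAt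

lemma hasFDerivAt_fderiv_of_contDiffOn (hu : ContDiffOn ℝ 2 u (B (n + 1) R))
    {x : EuclideanSpace ℝ (Fin (n + 1))} (hx : x ∈ B (n + 1) R) :
    HasFDerivAt (fderiv ℝ u) (fderiv ℝ (fderiv ℝ u) x) x := by
  have h := (hu.contDiffAt (Metric.isOpen_ball.mem_nhds hx)).fderiv_right (m := 1) (by norm_num)
  exact (h.differentiableAt (by norm_num)).hasFDerivAt

/-- For a radial function, the second derivative in a direction orthogonal to the ray is the
radial derivative divided by the radius. -/
lemma radial_second_deriv_orthogonal (hu : ContDiffOn ℝ 2 u (B (n + 1) R))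
    (hrad : ∀ x ∈ B (n + 1) R, ∀ y ∈ B (n + 1) R, ‖x‖ = ‖y‖ → u x = u y)
    {r : ℝ} (hr : r ∈ Ioo 0 R) {e e' : EuclideanSpace ℝ (Fin (n + 1))} (he : ‖e‖ = 1)
    (he' : ‖e'‖ = 1) (ho : inner ℝ e e' = 0) :
    fderiv ℝ (fderiv ℝ u) (r • e) e' e' = fderiv ℝ u (r • e) e / r := by
  -- The circle of radius r in the plane of e and e'. Since u is constant along it, differentiating
  -- u(c(θ)) twice at θ = 0 gives D²u(c', c') + Du(c'') = 0, with c' = r e' and c'' = -r e.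
  set c : ℝ → EuclideanSpace ℝ (Fin (n + 1)) :=
    fun θ => (r * Real.cos θ) • e + (r * Real.sin θ) • e' with hcdef
  set c' : ℝ → EuclideanSpace ℝ (Fin (n + 1)) :=
    fun θ => (-(r * Real.sin θ)) • e + (r * Real.cos θ) • e' with hcdef'
  have hc : ∀ θ, HasDerivAt c (c' θ) θ := by
    intro θ
    have h1 := ((Real.hasDerivAt_cos θ).const_mul r).smul_const e
    have h2 := ((Real.hasDerivAt_sin θ).const_mul r).smul_const e'
    refine (h1.add h2).congr_deriv ?_
    simp [hcdef']
  have hc' : HasDerivAt c' (-(r • e)) 0 := by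
    have h1 := (((Real.hasDerivAt_sin 0).const_mul r).neg).smul_const e
    have h2 := ((Real.hasDerivAt_cos 0).const_mul r).smul_const e'
    refine (h1.add h2).congr_deriv ?_
    simp
  have hn : ∀ θ, ‖c θ‖ = r := by
    intro θ
    have h : ‖c θ‖ ^ 2 = r ^ 2 := by
      rw [hcdef, norm_add_sq_real, norm_smul, norm_smul, inner_smul_left, inner_smul_right, ho,
        he, he']
      simp only [Real.norm_eq_abs, mul_one, sq_abs, mul_zero, add_zero]
      linear_combination r ^ 2 * Real.cos_sq_add_sin_sq θ
    exact (sq_eq_sq₀ (norm_nonneg _) hr.1.le).1 h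
  have hmem : ∀ θ, c θ ∈ B (n + 1) R := fun θ => by simp [hn θ, hr.2]
  have hzero : ∀ θ, fderiv ℝ u (c θ) (c' θ) = 0 := by
    intro θ
    have h1 := (hasFDerivAt_of_contDiffOn hu (hmem θ)).comp_hasDerivAt θ (hc θ)
    have h2 : u ∘ c = fun _ => u (c 0) :=
      funext fun t => hrad _ (hmem t) _ (hmem 0) (by rw [hn, hn])
    rw [h2] at h1
    exact h1.unique (hasDerivAt_const θ _)
  have hc0 : c 0 = r • e := by simp [hcdef]
  have hc0' : c' 0 = r • e' := by simp [hcdef']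
  have h1 := (hasFDerivAt_fderiv_of_contDiffOn hu (hmem 0)).comp_hasDerivAt 0 (hc 0)
  have h2 := h1.clm_apply hc'
  have h3 : (fun θ => (fderiv ℝ u ∘ c) θ (c' θ)) = fun _ => 0 := funext hzero
  rw [h3] at h2
  have h4 := h2.unique (hasDerivAt_const (0 : ℝ) (0 : ℝ))
  simp only [Function.comp, hc0, hc0', map_smul, map_neg, smul_eq_mul,
    smul_apply] at h4
  have := hr.1
  field_simp
  have h5 : r * (r * fderiv ℝ (fderiv ℝ u) (r • e) e' e' - fderiv ℝ u (r • e) e) = 0 := by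
    linarith
  have := (mul_eq_zero.1 h5).resolve_left this.ne'
  linarith

lemma hasDerivAt_along_ray (hu : ContDiffOn ℝ 2 u (B (n + 1) R))
    (e : EuclideanSpace ℝ (Fin (n + 1))) {r : ℝ} (hr : r • e ∈ B (n + 1) R) :
    HasDerivAt (fun t : ℝ => u (t • e)) (fderiv ℝ u (r • e) e) r := by
  have hl : HasDerivAt (fun t : ℝ => t • e) e r := by simpa using (hasDerivAt_id r).smul_const e
  exact (hasFDerivAt_of_contDiffOn hu hr).comp_hasDerivAt r hl

lemma hasDerivAt_clm_along_ray {E : Type*} [NormedAddCommGroup E] [NormedSpace ℝ E]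
    {L : E → E →L[ℝ] ℝ} {e : E} {r : ℝ} {L' : E →L[ℝ] E →L[ℝ] ℝ} (hL : HasFDerivAt L L' (r • e)) :
    HasDerivAt (fun t : ℝ => L (t • e) e) (L' e e) r := by
  have hl : HasDerivAt (fun t : ℝ => t • e) e r := by simpa using (hasDerivAt_id r).smul_const e
  have h1 : HasDerivAt (fun t : ℝ => L (t • e)) (L' e) r := hL.comp_hasDerivAt r hl
  have h := h1.clm_apply (hasDerivAt_const r e)
  rwa [map_zero, add_zero] at h

lemma hasDerivAt_fderiv_along_ray (hu : ContDiffOn ℝ 2 u (B (n + 1) R))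
    (e : EuclideanSpace ℝ (Fin (n + 1))) {r : ℝ} (hr : r • e ∈ B (n + 1) R) :
    HasDerivAt (fun t : ℝ => fderiv ℝ u (t • e) e) (fderiv ℝ (fderiv ℝ u) (r • e) e e) r :=
  hasDerivAt_clm_along_ray (hasFDerivAt_fderiv_of_contDiffOn hu hr)

/-- A radial `C²` solution of `Δu = f(‖x‖)` is a constant plus the radial Newtonian potential. -/
theorem eq_newt_of_laplacian_eq (hR : 0 < R) (hu : ContDiffOn ℝ 2 u (B (n + 1) R))
    (hrad : ∀ x ∈ B (n + 1) R, ∀ y ∈ B (n + 1) R, ‖x‖ = ‖y‖ → u x = u y) {f : ℝ → ℝ}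
    (hf : ContinuousOn f (Ico 0 R))
    (hΔ : ∀ x ∈ B (n + 1) R, Laplacian.laplacian u x = f ‖x‖)
    {x : EuclideanSpace ℝ (Fin (n + 1))} (hx : x ∈ B (n + 1) R) :
    u x = u 0 + newt n f ‖x‖ := by
  set b := EuclideanSpace.basisFun (Fin (n + 1)) ℝ
  set e := b 0 with he_def
  have he : ‖e‖ = 1 := b.orthonormal.1 0
  have hmem : ∀ r : ℝ, r ∈ Ico 0 R → r • e ∈ B (n + 1) R := fun r hr => by
    simp [norm_smul, he, abs_of_nonneg hr.1, hr.2]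
  let φ : ℝ → ℝ := fun t => u (t • e)
  let φ' : ℝ → ℝ := fun t => fderiv ℝ u (t • e) e
  have hφ : ∀ r ∈ Ico 0 R, HasDerivAt φ (φ' r) r := fun r hr =>
    hasDerivAt_along_ray hu e (hmem r hr)
  have hφ' : ∀ r ∈ Ico 0 R, HasDerivAt φ' (fderiv ℝ (fderiv ℝ u) (r • e) e e) r := fun r hr =>
    hasDerivAt_fderiv_along_ray hu e (hmem r hr)
  -- By radial symmetry φ is even.
  have hφ'0 : φ' 0 = 0 := by
    have h0 : (0 : ℝ) ∈ Ico 0 R := ⟨le_rfl, hR⟩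
    have h1 := hφ 0 h0
    have h2 : HasDerivAt (fun t => φ (-t)) (-φ' 0) 0 := by
      have h3 : HasDerivAt φ (φ' 0) (-0) := by simpa using h1
      simpa [Function.comp_def] using h3.comp 0 (hasDerivAt_neg (0 : ℝ))
    have h3 : (fun t => φ (-t)) =ᶠ[𝓝 0] φ := by
      filter_upwards [Metric.ball_mem_nhds (0 : ℝ) hR] with t ht
      have ht' : |t| < R := by simpa using ht
      exact hrad _ (by simp [norm_smul, he, ht']) _ (by simp [norm_smul, he, ht'])
        (by simp [norm_smul])
    have h4 := (h2.congr_of_eventuallyEq h3.symm).unique h1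
    linarith
  have hode : ∀ r ∈ Ioo 0 R, HasDerivAt φ' (f r - n * (φ' r / r)) r := by
    intro r hr
    have hr' : r ∈ Ico 0 R := ⟨hr.1.le, hr.2⟩
    refine (hφ' r hr').congr_deriv ?_
    have h1 := hΔ _ (hmem r hr')
    rw [InnerProductSpace.laplacian_eq_iteratedFDeriv_orthonormalBasis _ b] at h1
    beta_reduce at h1
    rw [Fin.sum_univ_succ,
      norm_smul, he, mul_one, Real.norm_eq_abs, abs_of_pos hr.1] at h1
    have h2 : ∀ i : Fin n, fderiv ℝ (fderiv ℝ u) (r • e) (b i.succ) (b i.succ) = φ' r / r :=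
      fun i => radial_second_deriv_orthogonal hu hrad hr he (b.orthonormal.1 _)
        (b.orthonormal.2 (Fin.succ_ne_zero i).symm)
    simp only [iteratedFDeriv_two_apply, Matrix.cons_val_zero, Matrix.cons_val_one, h2,
      Finset.sum_const, Finset.card_univ, Fintype.card_fin, nsmul_eq_mul] at h1
    linarith
  -- Both φ' and s · avg solve y' = f - n y / s. With the integrating factor sⁿ their difference is
  -- constant, and it vanishes at 0; for n = 0 this last point needs φ'(0) = 0.
  have hslope : ∀ r ∈ Ioo 0 R, φ' r = r * avg n f r := by
    intro r hr
    have hc : ContinuousOn (fun s => s ^ n * (φ' s - s * avg n f s)) (Ico 0 R) :=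
      (continuousOn_id.pow n).mul
        (ContinuousOn.sub (fun s hs => (hφ' s hs).continuousAt.continuousWithinAt)
          (continuousOn_id.mul (continuousOn_avg n hf)))
    have hd : ∀ s ∈ Ioo 0 R, HasDerivAt (fun s => s ^ n * (φ' s - s * avg n f s)) 0 s := by
      intro s hs
      refine ((hasDerivAt_pow n s).mul ((hode s hs).sub
        (hasDerivAt_mul_avg_of_continuousOn n hf hs))).congr_deriv ?_
      have hs0 := hs.1.ne'
      rcases n with _ | m
      · simp
      · simp only [Nat.add_sub_cancel, Pi.sub_apply]
        field_simp
        push_cast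
        ring
    have h := eq_of_hasDerivAt_zero hc hd ⟨hr.1.le, hr.2⟩
    simp only [hφ'0, zero_mul, sub_zero, mul_zero] at h
    have := (mul_eq_zero.1 h).resolve_left (pow_pos hr.1 n).ne'
    linarith
  have hxR : ‖x‖ ∈ Ico 0 R := ⟨norm_nonneg x, by simpa using hx⟩
  have hfin := eq_of_hasDerivAt_zero (g := fun r => φ r - newt n f r)
    (ContinuousOn.sub (fun s hs => (hφ s hs).continuousAt.continuousWithinAt)
      (continuousOn_newt n hf))
    (fun s hs => ((hφ s ⟨hs.1.le, hs.2⟩).sub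
      (hasDerivAt_newt_of_continuousOn n hf hs)).congr_deriv (by rw [hslope s hs, sub_self])) hxR
  have hxe : u x = φ ‖x‖ := hrad _ hx _ (hmem _ hxR) (by simp [norm_smul, he])
  simp only [newt_zero, sub_zero] at hfin
  have h0 : φ 0 = u 0 := by simp [φ]
  linarith

end Forward

/-- The device by which every differential inequality below is integrated. Derivatives are required
only in the open interval, so the endpoint r = 0 and noninteger powers cause no difficulty. -/
lemma sub_le_sub_of_hasDerivAt_le {f g f' g' : ℝ → ℝ} {a b : ℝ} (hab : a ≤ b)
    (hf : ContinuousOn f (Icc a b)) (hg : ContinuousOn g (Icc a b))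
    (hf' : ∀ x ∈ Ioo a b, HasDerivAt f (f' x) x) (hg' : ∀ x ∈ Ioo a b, HasDerivAt g (g' x) x)
    (hle : ∀ x ∈ Ioo a b, f' x ≤ g' x) : f b - f a ≤ g b - g a := by
  have h := monotoneOn_of_deriv_nonneg (f := fun x => g x - f x) (convex_Icc a b) (hg.sub hf)
    (fun x hx => by
      rw [interior_Icc] at hx
      exact ((hg' x hx).sub (hf' x hx)).differentiableAt.differentiableWithinAt)
    (fun x hx => by
      rw [interior_Icc] at hx
      have hd : deriv (fun x => g x - f x) x = g' x - f' x := ((hg' x hx).sub (hf' x hx)).deriv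
      rw [hd]
      exact sub_nonneg.2 (hle x hx))
  have := h ⟨le_rfl, hab⟩ ⟨hab, le_rfl⟩ hab
  simp only at this
  linarith

/-! ### The radial integral equation and its monotonicity properties -/

lemma Icc_subset_Ico_of_lt {r s R : ℝ} (hr : 0 ≤ r) (hs : s < R) : Icc r s ⊆ Ico 0 R :=
  fun _ ht => ⟨hr.trans ht.1, ht.2.trans_lt hs⟩

/-- The radial derivative of `u` when `Δu = |x|^a v^p`. -/
noncomputable def slope (n : ℕ) (a p : ℝ) (v : ℝ → ℝ) (r : ℝ) : ℝ :=
  r * avg n (fun t => t ^ a * v t ^ p) r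

/-- The right-hand side of the equation for `v`. -/
noncomputable def source (n : ℕ) (a b p : ℝ) (h v : ℝ → ℝ) (t : ℝ) : ℝ :=
  t ^ b * h (slope n a p v t)

/-- `v` is a positive solution on `[0, R)` of the radial integral equation equivalent to the
system. -/
structure IsProfile (n : ℕ) (R a b p : ℝ) (h v : ℝ → ℝ) : Prop where
  cont : ContinuousOn v (Ico 0 R)
  pos : ∀ r ∈ Ico 0 R, 0 < v r
  eq : ∀ r ∈ Ico 0 R, v r = v 0 + newt n (source n a b p h v) r

/-- The standing assumptions on the exponents and on `h`, extended to the whole line. -/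
structure Data (a b p : ℝ) (h : ℝ → ℝ) : Prop where
  ha : 0 ≤ a
  hb : 0 ≤ b
  hp : 0 < p
  cont : Continuous h
  mono : Monotone h
  pos : ∀ t, 0 < t → 0 < h t
  nonneg : ∀ t, 0 ≤ h t

section Slope

variable {n : ℕ} {a p R r : ℝ} {f v : ℝ → ℝ}

/-- For nonnegative nondecreasing f, 0 ≤ (n + 1) avg ≤ f. Thus the first-order term n avg costs at
most the factor 1 / (n + 1), and the dimension affects only constants. -/
lemma mul_avg_deriv_bounds (hf : ContinuousOn f (Ico 0 R)) (hm : MonotoneOn f (Ico 0 R))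
    (h0 : ∀ t ∈ Ico 0 R, 0 ≤ f t) (hr : r ∈ Ico 0 R) :
    f r / (n + 1) ≤ f r - n * avg n f r ∧ f r - n * avg n f r ≤ f r := by
  have hs : Icc 0 r ⊆ Ico 0 R := Icc_subset_Ico_of_lt le_rfl hr.2
  have h1 : (n + 1) * avg n f r ≤ f r :=
    avg_le_of_le n hr.1 (hf.mono hs) fun t ht => hm (hs ht) hr ht.2
  have h2 : 0 ≤ avg n f r := avg_nonneg n hr.1 fun t ht => h0 t (hs ht)
  have h3 : (0 : ℝ) ≤ n * avg n f r := by positivity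
  refine ⟨?_, by linarith⟩
  rw [div_le_iff₀ (by positivity)]
  nlinarith

lemma continuousOn_weight (ha : 0 ≤ a) (hp : 0 < p) (hv : ContinuousOn v (Ico 0 R)) :
    ContinuousOn (fun t => t ^ a * v t ^ p) (Ico 0 R) :=
  (continuousOn_id.rpow_const fun _ _ => Or.inr ha).mul
    (hv.rpow_const fun _ _ => Or.inr hp.le)

lemma monotoneOn_weight (ha : 0 ≤ a) (hp : 0 < p) (hv : MonotoneOn v (Ico 0 R))
    (h0 : ∀ t ∈ Ico 0 R, 0 < v t) : MonotoneOn (fun t => t ^ a * v t ^ p) (Ico 0 R) := by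
  intro s hs t ht hst
  have h1 := hs.1
  have h2 := (h0 s hs).le
  have h3 := hv hs ht hst
  have h4 : 0 ≤ t ^ a := Real.rpow_nonneg ht.1 _
  simp only
  gcongr

lemma weight_nonneg (h0 : ∀ t ∈ Ico 0 R, 0 < v t) (t : ℝ) (ht : t ∈ Ico 0 R) :
    0 ≤ t ^ a * v t ^ p :=
  mul_nonneg (Real.rpow_nonneg ht.1 _) (Real.rpow_nonneg (h0 t ht).le _)

lemma continuousOn_slope (ha : 0 ≤ a) (hp : 0 < p) (hv : ContinuousOn v (Ico 0 R)) :
    ContinuousOn (slope n a p v) (Ico 0 R) :=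
  continuousOn_id.mul (continuousOn_avg n (continuousOn_weight ha hp hv))

lemma slope_nonneg (h0 : ∀ t ∈ Ico 0 R, 0 < v t) (hr : r ∈ Ico 0 R) : 0 ≤ slope n a p v r :=
  mul_nonneg hr.1 (avg_nonneg n hr.1 fun t ht =>
    weight_nonneg h0 t (Icc_subset_Ico_of_lt le_rfl hr.2 ht))

end Slope

section Profile

variable {n : ℕ} {a b p R : ℝ} {h v : ℝ → ℝ}

lemma continuousOn_source (D : Data a b p h) (hv : ContinuousOn v (Ico 0 R)) :
    ContinuousOn (source n a b p h v) (Ico 0 R) :=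
  (continuousOn_id.rpow_const fun _ _ => Or.inr D.hb).mul
    (D.cont.comp_continuousOn (continuousOn_slope D.ha D.hp hv))

lemma source_nonneg (D : Data a b p h) {t : ℝ} (ht : 0 ≤ t) : 0 ≤ source n a b p h v t :=
  mul_nonneg (Real.rpow_nonneg ht _) (D.nonneg _)

lemma vel_nonneg (D : Data a b p h) {r : ℝ} (hr : 0 ≤ r) : 0 ≤ r * avg n (source n a b p h v) r :=
  mul_nonneg hr (avg_nonneg n hr fun _ ht => source_nonneg D ht.1)

namespace IsProfile

variable (D : Data a b p h) (hv : IsProfile n R a b p h v)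
include D hv

lemma hasDerivAt {r : ℝ} (hr : r ∈ Ioo 0 R) :
    HasDerivAt v (r * avg n (source n a b p h v) r) r := by
  refine ((hasDerivAt_newt_of_continuousOn n (continuousOn_source D hv.cont) hr).const_add
    (v 0)).congr_of_eventuallyEq ?_
  filter_upwards [Ioo_mem_nhds hr.1 hr.2] with s hs
  exact hv.eq s ⟨hs.1.le, hs.2⟩

lemma monotoneOn : MonotoneOn v (Ico 0 R) := by
  intro s hs t ht hst
  have := sub_le_sub_of_hasDerivAt_le (f := fun _ => 0) (f' := fun _ => 0) hst continuousOn_const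
    (hv.cont.mono (Icc_subset_Ico_of_lt hs.1 ht.2)) (fun x _ => hasDerivAt_const x 0)
    (fun x hx => hv.hasDerivAt D ⟨hs.1.trans_lt hx.1, hx.2.trans ht.2⟩)
    (fun x hx => vel_nonneg D (hs.1.trans hx.1.le))
  linarith

/-- The weight r^a v^p is nondecreasing because v is, so the bounds on the derivative of r · avg
apply. -/
lemma hasDerivAt_slope {r : ℝ} (hr : r ∈ Ioo 0 R) : ∃ w', HasDerivAt (slope n a p v) w' r ∧
    r ^ a * v r ^ p / (n + 1) ≤ w' ∧ w' ≤ r ^ a * v r ^ p := by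
  have hf := continuousOn_weight D.ha D.hp hv.cont
  have hm := monotoneOn_weight D.ha D.hp (hv.monotoneOn D) hv.pos
  have hb := mul_avg_deriv_bounds (n := n) hf hm (weight_nonneg hv.pos) ⟨hr.1.le, hr.2⟩
  exact ⟨_, hasDerivAt_mul_avg_of_continuousOn n hf hr, hb.1, hb.2⟩

lemma deriv_slope_bounds {r : ℝ} (hr : r ∈ Ioo 0 R) :
    HasDerivAt (slope n a p v) (deriv (slope n a p v) r) r ∧
    r ^ a * v r ^ p / (n + 1) ≤ deriv (slope n a p v) r ∧
    deriv (slope n a p v) r ≤ r ^ a * v r ^ p := by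
  obtain ⟨w', h1, h2⟩ := hv.hasDerivAt_slope D hr
  rw [h1.deriv]
  exact ⟨h1, h2⟩

lemma deriv_slope_pos {r : ℝ} (hr : r ∈ Ioo 0 R) : 0 < deriv (slope n a p v) r := by
  have h1 := Real.rpow_pos_of_pos hr.1 a
  have h2 := Real.rpow_pos_of_pos (hv.pos r ⟨hr.1.le, hr.2⟩) p
  exact lt_of_lt_of_le (by positivity) (hv.deriv_slope_bounds D hr).2.1

lemma strictMonoOn_slope : StrictMonoOn (slope n a p v) (Ico 0 R) :=
  strictMonoOn_of_deriv_pos (convex_Ico 0 R) (continuousOn_slope D.ha D.hp hv.cont)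
    fun r hr => hv.deriv_slope_pos D (by rwa [interior_Ico] at hr)

lemma slope_pos {r : ℝ} (hr : r ∈ Ioo 0 R) : 0 < slope n a p v r := by
  have h0 : slope n a p v 0 = 0 := by simp [slope]
  rw [← h0]
  exact hv.strictMonoOn_slope D ⟨le_rfl, hr.1.trans hr.2⟩ ⟨hr.1.le, hr.2⟩ hr.1

lemma monotoneOn_source : MonotoneOn (source n a b p h v) (Ico 0 R) := by
  intro s hs t ht hst
  have h1 := D.mono ((hv.strictMonoOn_slope D).monotoneOn hs ht hst)
  have h2 := hs.1
  have h3 := D.nonneg (slope n a p v s)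
  have h4 := D.hb
  have h5 : 0 ≤ t ^ b := Real.rpow_nonneg ht.1 _
  simp only [source]
  gcongr

lemma hasDerivAt_vel {r : ℝ} (hr : r ∈ Ioo 0 R) :
    ∃ z', HasDerivAt (fun r => r * avg n (source n a b p h v) r) z' r ∧
    r ^ b * h (slope n a p v r) / (n + 1) ≤ z' ∧ z' ≤ r ^ b * h (slope n a p v r) := by
  have hf := continuousOn_source (n := n) D hv.cont
  have hb := mul_avg_deriv_bounds (n := n) hf (hv.monotoneOn_source D)
    (fun t ht => source_nonneg D ht.1) ⟨hr.1.le, hr.2⟩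
  exact ⟨_, hasDerivAt_mul_avg_of_continuousOn n hf hr, hb.1, hb.2⟩

lemma continuousOn_vel : ContinuousOn (fun r => r * avg n (source n a b p h v) r) (Ico 0 R) :=
  continuousOn_id.mul (continuousOn_avg n (continuousOn_source D hv.cont))

end IsProfile

end Profile

/-! ### The iterated primitive of `h` -/

section Primitive

variable {a b p : ℝ} {h : ℝ → ℝ}

/-- The iterated primitive `E(s) = ∫₀ˢ H(t) dt`. -/
noncomputable def primPrim (h : ℝ → ℝ) (s : ℝ) : ℝ := ∫ t in (0 : ℝ)..s, H h t

lemma hasDerivAt_integral_of_continuous {f : ℝ → ℝ} (hf : Continuous f) (c x : ℝ) :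
    HasDerivAt (fun s => ∫ t in c..s, f t) (f x) x :=
  intervalIntegral.integral_hasDerivAt_right (hf.intervalIntegrable _ _)
    (hf.stronglyMeasurableAtFilter _ _) hf.continuousAt

lemma hasDerivAt_H (hc : Continuous h) (s : ℝ) : HasDerivAt (H h) (h s) s :=
  hasDerivAt_integral_of_continuous hc 0 s

lemma continuous_H (hc : Continuous h) : Continuous (H h) :=
  continuous_iff_continuousAt.2 fun s => (hasDerivAt_H hc s).continuousAt

lemma hasDerivAt_primPrim (hc : Continuous h) (s : ℝ) : HasDerivAt (primPrim h) (H h s) s :=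
  hasDerivAt_integral_of_continuous (continuous_H hc) 0 s

lemma continuous_primPrim (hc : Continuous h) : Continuous (primPrim h) :=
  continuous_iff_continuousAt.2 fun s => (hasDerivAt_primPrim hc s).continuousAt

lemma monotone_H (D : Data a b p h) : Monotone (H h) :=
  monotone_of_deriv_nonneg (fun s => (hasDerivAt_H D.cont s).differentiableAt)
    fun s => by rw [(hasDerivAt_H D.cont s).deriv]; exact D.nonneg s

lemma H_zero : H h 0 = 0 := by simp [H]

lemma primPrim_zero : primPrim h 0 = 0 := by simp [primPrim]

lemma H_nonneg (D : Data a b p h) {s : ℝ} (hs : 0 ≤ s) : 0 ≤ H h s := by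
  rw [← H_zero (h := h)]; exact monotone_H D hs

lemma H_pos (D : Data a b p h) {s : ℝ} (hs : 0 < s) : 0 < H h s :=
  intervalIntegral.intervalIntegral_pos_of_pos_on (D.cont.intervalIntegrable _ _)
    (fun t ht => D.pos t ht.1) hs

lemma primPrim_pos (D : Data a b p h) {s : ℝ} (hs : 0 < s) : 0 < primPrim h s :=
  intervalIntegral.intervalIntegral_pos_of_pos_on ((continuous_H D.cont).intervalIntegrable _ _)
    (fun _ ht => H_pos D ht.1) hs

lemma primPrim_nonneg (D : Data a b p h) {s : ℝ} (hs : 0 ≤ s) : 0 ≤ primPrim h s := by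
  rcases hs.eq_or_lt with rfl | hs
  · rw [primPrim_zero]
  · exact (primPrim_pos D hs).le

lemma denom_eq (s : ℝ) : denom p h s = primPrim h s ^ (p / (2 * p + 1)) := rfl

lemma denom_pos (D : Data a b p h) {s : ℝ} (hs : 0 < s) : 0 < denom p h s :=
  Real.rpow_pos_of_pos (primPrim_pos D hs) _

lemma continuous_denom (D : Data a b p h) : Continuous (denom p h) :=
  (continuous_primPrim D.cont).rpow_const fun _ => Or.inr (by have := D.hp; positivity)

/-- By convexity, `E` dominates a line through the origin. -/
lemma mul_primPrim_le (D : Data a b p h) {s t : ℝ} (hs : 0 ≤ s) (hst : s ≤ t) :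
    t * primPrim h s ≤ s * primPrim h t := by
  have h1 : primPrim h s - primPrim h 0 ≤ H h s * s - H h s * 0 :=
    sub_le_sub_of_hasDerivAt_le hs (continuous_primPrim D.cont).continuousOn
      (by fun_prop) (fun x _ => hasDerivAt_primPrim D.cont x)
      (fun x _ => (hasDerivAt_id x).const_mul _) fun x hx => by
        rw [mul_one]; exact monotone_H D hx.2.le
  have h2 : H h s * t - H h s * s ≤ primPrim h t - primPrim h s :=
    sub_le_sub_of_hasDerivAt_le hst (by fun_prop) (continuous_primPrim D.cont).continuousOn
      (fun x _ => (hasDerivAt_id x).const_mul _)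
      (fun x _ => hasDerivAt_primPrim D.cont x) fun x hx => by
        rw [mul_one]; exact monotone_H D hx.1.le
  rw [primPrim_zero] at h1
  nlinarith [mul_le_mul_of_nonneg_left h2 hs, mul_le_mul_of_nonneg_left h1 (sub_nonneg.2 hst)]

/-- Source of the exponent p / (2p + 1): energy estimates control y^(2p+1), whereas the equation for
w contains y^p. -/
lemma rpow_le_denom {c s y : ℝ} (D : Data a b p h) (hy : 0 ≤ y) (hc : 0 ≤ c) (hs : 0 ≤ s)
    (hle : y ^ (2 * p + 1) ≤ c * primPrim h s) :
    y ^ p ≤ c ^ (p / (2 * p + 1)) * denom p h s := by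
  have hp := D.hp
  rw [denom_eq, ← Real.mul_rpow hc (primPrim_nonneg D hs)]
  calc y ^ p = (y ^ (2 * p + 1)) ^ (p / (2 * p + 1)) := by
        rw [← Real.rpow_mul hy]; congr 1; field_simp
    _ ≤ _ := Real.rpow_le_rpow (by positivity) hle (by positivity)

lemma denom_le_rpow {c s y : ℝ} (D : Data a b p h) (hy : 0 ≤ y) (hc : 0 ≤ c) (hs : 0 ≤ s)
    (hle : c * primPrim h s ≤ y ^ (2 * p + 1)) :
    c ^ (p / (2 * p + 1)) * denom p h s ≤ y ^ p := by
  have hp := D.hp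
  have hE := primPrim_nonneg D hs
  rw [denom_eq, ← Real.mul_rpow hc hE]
  calc (c * primPrim h s) ^ (p / (2 * p + 1)) ≤ (y ^ (2 * p + 1)) ^ (p / (2 * p + 1)) :=
        Real.rpow_le_rpow (by positivity) hle (by positivity)
    _ = y ^ p := by rw [← Real.rpow_mul hy]; congr 1; field_simp

end Primitive

/-! ### Two-sided differential inequality for the radial derivative of `u` -/

section Estimates

variable {n : ℕ} {a b p R : ℝ} {h v : ℝ → ℝ}

namespace IsProfile

variable (D : Data a b p h) (hv : IsProfile n R a b p h v)
include D hv

/-- The velocity bound `v'² ≤ 2 R^b h(w) v`. -/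
lemma sq_vel_le {r : ℝ} (hr : r ∈ Ioo 0 R) :
    (r * avg n (source n a b p h v) r) ^ 2 ≤ 2 * R ^ b * h (slope n a p v r) * v r := by
  have hsub : Icc 0 r ⊆ Ico 0 R := Icc_subset_Ico_of_lt le_rfl hr.2
  choose! z' hz' _ hz'2 using fun s (hs : s ∈ Ioo 0 R) => hv.hasDerivAt_vel D hs
  -- Integrate (v'²)' = 2 v' v'' ≤ 2 R^b h(w(r)) v' over [0, r], with h(w) frozen at its largest
  -- value, at the right endpoint.
  have key := sub_le_sub_of_hasDerivAt_le hr.1.le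
    (((hv.continuousOn_vel D).mono hsub).pow 2)
    ((continuousOn_const (c := 2 * R ^ b * h (slope n a p v r))).mul (hv.cont.mono hsub))
    (fun s hs => (hz' s ⟨hs.1, hs.2.trans hr.2⟩).pow 2)
    (fun s hs => (hv.hasDerivAt D ⟨hs.1, hs.2.trans hr.2⟩).const_mul _) (fun s hs => by
      have h1 := hz'2 s ⟨hs.1, hs.2.trans hr.2⟩
      have h2 : h (slope n a p v s) ≤ h (slope n a p v r) :=
        D.mono ((hv.strictMonoOn_slope D).monotoneOn ⟨hs.1.le, hs.2.trans hr.2⟩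
          ⟨hr.1.le, hr.2⟩ hs.2.le)
      have h3 : s ^ b ≤ R ^ b := Real.rpow_le_rpow hs.1.le (hs.2.trans hr.2).le D.hb
      have h4 := vel_nonneg (n := n) (v := v) D hs.1.le
      have h5 : z' s ≤ R ^ b * h (slope n a p v r) :=
        h1.trans (mul_le_mul h3 h2 (D.nonneg _) (Real.rpow_nonneg (hs.1.trans (hs.2.trans hr.2)).le _))
      have := mul_le_mul_of_nonneg_left h5 h4
      simp only [Nat.cast_ofNat, Nat.add_one_sub_one, pow_one]
      linarith)
  have h0 : 0 ≤ 2 * R ^ b * h (slope n a p v r) * v 0 :=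
    mul_nonneg (mul_nonneg (by have := hr.1.trans hr.2; positivity) (D.nonneg _))
      (hv.pos 0 ⟨le_rfl, hr.1.trans hr.2⟩).le
  simp only [zero_mul, Pi.pow_apply, Pi.mul_apply] at key
  nlinarith

lemma hasDerivAt_vel_mul_rpow {r z' : ℝ} (hr : r ∈ Ioo 0 R)
    (hz' : HasDerivAt (fun r => r * avg n (source n a b p h v) r) z' r) :
    HasDerivAt (fun r => r * avg n (source n a b p h v) r * v r ^ p)
      (z' * v r ^ p + p * v r ^ (p - 1) * (r * avg n (source n a b p h v) r) ^ 2) r := by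
  refine (hz'.mul ((hv.hasDerivAt D hr).rpow_const (p := p)
    (Or.inl (hv.pos r ⟨hr.1.le, hr.2⟩).ne'))).congr_deriv ?_
  ring

lemma hasDerivAt_rpow {r : ℝ} (hr : r ∈ Ioo 0 R) :
    HasDerivAt (fun r => v r ^ (2 * p + 1))
      ((2 * p + 1) * v r ^ p * (r * avg n (source n a b p h v) r * v r ^ p)) r := by
  have h0 := hv.pos r ⟨hr.1.le, hr.2⟩
  refine ((hv.hasDerivAt D hr).rpow_const (p := 2 * p + 1) (Or.inl h0.ne')).congr_deriv ?_
  rw [add_sub_cancel_right, two_mul, Real.rpow_add h0]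
  ring

/-- The derivative of v' v^p is v'' v^p + p v^(p-1) v'², at most (1 + 2p) R^b h(w) v^p by the
velocity bound. Replacing v^p by (n + 1) w' / r₀^a makes this a multiple of (H(w))'; the start r₀ >
0 keeps s^a away from 0. -/
lemma vel_mul_rpow_le {r₀ r : ℝ} (h0 : 0 < r₀) (hr0 : r₀ ≤ r) (hr : r < R) :
    r * avg n (source n a b p h v) r * v r ^ p ≤
      (1 + 2 * p) * R ^ b * (n + 1) / r₀ ^ a * H h (slope n a p v r) +
        r₀ * avg n (source n a b p h v) r₀ * v r₀ ^ p := by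
  have hR : 0 < R := h0.trans_le (hr0.trans hr.le)
  have hsub : Icc r₀ r ⊆ Ico 0 R := Icc_subset_Ico_of_lt h0.le hr
  have hioo : ∀ s ∈ Ioo r₀ r, s ∈ Ioo 0 R := fun s hs => ⟨h0.trans hs.1, hs.2.trans hr⟩
  have hp := D.hp
  choose! z' hz' _ hz'2 using fun s (hs : s ∈ Ioo 0 R) => hv.hasDerivAt_vel D hs
  have key := sub_le_sub_of_hasDerivAt_le (g := fun s =>
      (1 + 2 * p) * R ^ b * (n + 1) / r₀ ^ a * H h (slope n a p v s)) hr0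
    (((hv.continuousOn_vel D).mono hsub).mul
      ((hv.cont.mono hsub).rpow_const fun _ _ => Or.inr hp.le))
    (continuousOn_const.mul ((continuous_H D.cont).comp_continuousOn
      ((continuousOn_slope D.ha D.hp hv.cont).mono hsub)))
    (fun s hs => hv.hasDerivAt_vel_mul_rpow D (hioo s hs) (hz' s (hioo s hs)))
    (fun s hs => (((hasDerivAt_H D.cont _).comp s
      (hv.deriv_slope_bounds D (hioo s hs)).1).const_mul _)) (fun s hs => by
      have h1 := hz'2 s (hioo s hs)
      have h2 := hv.sq_vel_le D (hioo s hs)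
      have h3 := (hv.deriv_slope_bounds D (hioo s hs)).2.1
      have hv0 := hv.pos s ⟨(h0.trans hs.1).le, hs.2.trans hr⟩
      have h4 : s ^ b ≤ R ^ b := Real.rpow_le_rpow (h0.trans hs.1).le (hs.2.trans hr).le D.hb
      have h5 : r₀ ^ a ≤ s ^ a := Real.rpow_le_rpow h0.le hs.1.le D.ha
      have h6 : v s ^ (p - 1) * v s = v s ^ p := by
        rw [Real.rpow_sub_one hv0.ne', div_mul_cancel₀ _ hv0.ne']
      have h7 := D.nonneg (slope n a p v s)
      have hpw : 0 < v s ^ p := Real.rpow_pos_of_pos hv0 p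
      have hpw1 : 0 < v s ^ (p - 1) := Real.rpow_pos_of_pos hv0 _
      have hra : 0 < r₀ ^ a := Real.rpow_pos_of_pos h0 a
      have hRb : 0 < R ^ b := Real.rpow_pos_of_pos hR b
      set w' := deriv (slope n a p v) s
      set η := h (slope n a p v s)
      have h8 : z' s * v s ^ p ≤ R ^ b * η * v s ^ p := by
        gcongr; exact h1.trans (by gcongr)
      have h9 : p * v s ^ (p - 1) * (s * avg n (source n a b p h v) s) ^ 2 ≤
          p * v s ^ (p - 1) * (2 * R ^ b * η * v s) := by gcongr
      have h10 : p * v s ^ (p - 1) * (2 * R ^ b * η * v s) = 2 * p * R ^ b * η * v s ^ p := by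
        rw [← h6]; ring
      have h11 : r₀ ^ a * v s ^ p ≤ (n + 1) * w' := by
        rw [div_le_iff₀ (by positivity)] at h3
        have := mul_le_mul_of_nonneg_right h5 hpw.le
        linarith
      have h12 : v s ^ p ≤ (n + 1) * w' / r₀ ^ a := by
        rw [le_div_iff₀ hra]; linarith
      calc _ ≤ (1 + 2 * p) * R ^ b * η * v s ^ p := by linarith
        _ ≤ (1 + 2 * p) * R ^ b * η * ((n + 1) * w' / r₀ ^ a) := by gcongr
        _ = _ := by ring)
  have hH : 0 ≤ H h (slope n a p v r₀) :=
    H_nonneg D (slope_nonneg hv.pos ⟨h0.le, hr0.trans_lt hr⟩)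
  have hC : 0 ≤ (1 + 2 * p) * R ^ b * (n + 1) / r₀ ^ a * H h (slope n a p v r₀) := by positivity
  simp only [Pi.mul_apply] at key
  linarith

/-- Upper differential inequality `w' ≤ C E(w)^{p/(2p+1)}`. -/
lemma exists_deriv_slope_le {r₀ : ℝ} (h0 : 0 < r₀) (hr₀ : r₀ < R) :
    ∃ C, 0 < C ∧ ∀ r ∈ Ico r₀ R, deriv (slope n a p v) r ≤ C * denom p h (slope n a p v r) := by
  have hR : 0 < R := h0.trans hr₀
  have hp := D.hp
  have hra : 0 < r₀ ^ a := Real.rpow_pos_of_pos h0 a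
  have hRa : 0 < R ^ a := Real.rpow_pos_of_pos hR a
  have hRb : 0 < R ^ b := Real.rpow_pos_of_pos hR b
  set C₁ := (1 + 2 * p) * R ^ b * (n + 1) / r₀ ^ a with hC₁
  have hC₁0 : 0 < C₁ := by positivity
  set K := r₀ * avg n (source n a b p h v) r₀ * v r₀ ^ p with hK
  have hvr₀ := hv.pos r₀ ⟨h0.le, hr₀⟩
  have hK0 : 0 ≤ K := mul_nonneg (vel_nonneg D h0.le) (Real.rpow_nonneg hvr₀.le _)
  set w₀ := slope n a p v r₀ with hw₀
  have hw₀0 : 0 < w₀ := hv.slope_pos D ⟨h0, hr₀⟩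
  have hE₀ : 0 < primPrim h w₀ := primPrim_pos D hw₀0
  set C₂ := (2 * p + 1) * (n + 1) / r₀ ^ a with hC₂
  have hC₂0 : 0 < C₂ := by positivity
  set K₂ := v r₀ ^ (2 * p + 1) with hK₂
  have hK₂0 : 0 < K₂ := by positivity
  -- Three contributions to v^(2p+1): the main term in E(w), the linear term in w and the initial
  -- value. Convexity of E absorbs the last two, through w ≤ (w₀ / E(w₀)) E(w) and 1 ≤ E(w) / E(w₀).
  set C₃ := C₂ * C₁ + C₂ * K * (w₀ / primPrim h w₀) + K₂ / primPrim h w₀ with hC₃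
  have hC₃0 : 0 < C₃ := by positivity
  refine ⟨R ^ a * C₃ ^ (p / (2 * p + 1)), by positivity, fun r hr => ?_⟩
  have hsub : Icc r₀ r ⊆ Ico 0 R := Icc_subset_Ico_of_lt h0.le hr.2
  have hioo : ∀ s ∈ Ioo r₀ r, s ∈ Ioo 0 R := fun s hs => ⟨h0.trans hs.1, hs.2.trans hr.2⟩
  have hcs := (continuousOn_slope (n := n) D.ha D.hp hv.cont).mono hsub
  have key := sub_le_sub_of_hasDerivAt_le
    (g := fun s => C₂ * (C₁ * primPrim h (slope n a p v s) + K * slope n a p v s)) hr.1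
    ((hv.cont.mono hsub).rpow_const fun _ _ => Or.inr (show 0 ≤ 2 * p + 1 by positivity))
    (continuousOn_const.mul ((continuousOn_const.mul
      ((continuous_primPrim D.cont).comp_continuousOn hcs)).add (continuousOn_const.mul hcs)))
    (fun s hs => hv.hasDerivAt_rpow D (hioo s hs))
    (fun s hs => by
      have hd := (hv.deriv_slope_bounds D (hioo s hs)).1
      exact ((((hasDerivAt_primPrim D.cont _).comp s hd).const_mul C₁).add
        (hd.const_mul K)).const_mul C₂) (fun s hs => by
      have h1 := hv.vel_mul_rpow_le D h0 hs.1.le (hs.2.trans hr.2)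
      have h3 := (hv.deriv_slope_bounds D (hioo s hs)).2.1
      have hv0 := hv.pos s ⟨(h0.trans hs.1).le, hs.2.trans hr.2⟩
      have h5 : r₀ ^ a ≤ s ^ a := Real.rpow_le_rpow h0.le hs.1.le D.ha
      have hpw : 0 < v s ^ p := Real.rpow_pos_of_pos hv0 p
      set w' := deriv (slope n a p v) s
      have h11 : r₀ ^ a * v s ^ p ≤ (n + 1) * w' := by
        rw [div_le_iff₀ (by positivity)] at h3
        have := mul_le_mul_of_nonneg_right h5 hpw.le
        linarith
      have h12 : v s ^ p ≤ (n + 1) * w' / r₀ ^ a := by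
        rw [le_div_iff₀ hra]; linarith
      have hH := H_nonneg D (slope_nonneg (n := n) (a := a) (p := p) hv.pos
        ⟨(h0.trans hs.1).le, hs.2.trans hr.2⟩)
      calc _ ≤ (2 * p + 1) * v s ^ p * (C₁ * H h (slope n a p v s) + K) := by gcongr
        _ ≤ (2 * p + 1) * ((n + 1) * w' / r₀ ^ a) * (C₁ * H h (slope n a p v s) + K) := by
            gcongr
        _ = _ := by simp only [hC₂]; ring)
  set w := slope n a p v r with hw
  have hw0 : w₀ ≤ w :=
    (hv.strictMonoOn_slope D).monotoneOn ⟨h0.le, hr₀⟩ ⟨h0.le.trans hr.1, hr.2⟩ hr.1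
  have hE : w * primPrim h w₀ ≤ w₀ * primPrim h w := mul_primPrim_le D hw₀0.le hw0
  have hE1 : w ≤ w₀ / primPrim h w₀ * primPrim h w := by
    rw [div_mul_eq_mul_div, le_div_iff₀ hE₀]; exact hE
  have hE2 : 1 ≤ primPrim h w / primPrim h w₀ := by
    rw [one_le_div hE₀]
    have := mul_le_mul_of_nonneg_right hw0 hE₀.le
    exact le_of_mul_le_mul_left (this.trans hE) hw₀0
  have hv0 := hv.pos r ⟨h0.le.trans hr.1, hr.2⟩
  have hbound : v r ^ (2 * p + 1) ≤ C₃ * primPrim h w := by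
    have h1 : 0 ≤ C₂ * (C₁ * primPrim h w₀ + K * w₀) := by positivity
    have h2 : C₂ * K * w ≤ C₂ * K * (w₀ / primPrim h w₀ * primPrim h w) := by gcongr
    have h3 : K₂ * 1 ≤ K₂ * (primPrim h w / primPrim h w₀) := by gcongr
    have h4 : C₃ * primPrim h w = C₂ * C₁ * primPrim h w +
        C₂ * K * (w₀ / primPrim h w₀ * primPrim h w) + K₂ * (primPrim h w / primPrim h w₀) := by
      rw [hC₃]; ring
    rw [h4]
    linarith
  have h1 := rpow_le_denom D hv0.le hC₃0.le (hw₀0.le.trans hw0) hbound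
  have h2 : r ^ a ≤ R ^ a := Real.rpow_le_rpow (h0.le.trans hr.1) hr.2.le D.ha
  calc deriv (slope n a p v) r ≤ r ^ a * v r ^ p :=
        (hv.deriv_slope_bounds D ⟨h0.trans_le hr.1, hr.2⟩).2.2
    _ ≤ R ^ a * (C₃ ^ (p / (2 * p + 1)) * denom p h w) := by gcongr
    _ = _ := by ring

end IsProfile

/-- Lower differential inequality `(w - w(r₀))' ≥ c E(w - w(r₀))^{p/(2p+1)}`, with a constant
independent of the solution. -/
lemma exists_le_deriv_slope (n : ℕ) (D : Data a b p h) {r₀ : ℝ} (h0 : 0 < r₀) (hr₀ : r₀ < R) :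
    ∃ c, 0 < c ∧ ∀ v, IsProfile n R a b p h v → ∀ r ∈ Ico r₀ R,
      c * denom p h (slope n a p v r - slope n a p v r₀) ≤ deriv (slope n a p v) r := by
  have hR : 0 < R := h0.trans hr₀
  have hp := D.hp
  have hra : 0 < r₀ ^ a := Real.rpow_pos_of_pos h0 a
  have hrb : 0 < r₀ ^ b := Real.rpow_pos_of_pos h0 b
  have hRa : 0 < R ^ a := Real.rpow_pos_of_pos hR a
  -- The constants combine v'' ≥ r₀^b h(w) / (n + 1) with two uses of v^p ≥ w' / R^a, one for each
  -- integration.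
  set α := r₀ ^ b / ((n + 1) * R ^ a) with hα
  have hα0 : 0 < α := by positivity
  set β := (2 * p + 1) * α / R ^ a with hβ
  have hβ0 : 0 < β := by positivity
  refine ⟨r₀ ^ a / (n + 1) * β ^ (p / (2 * p + 1)), by positivity, fun v hv r hr => ?_⟩
  set w₀ := slope n a p v r₀ with hw₀
  have hmono := (hv.strictMonoOn_slope D).monotoneOn
  have hy : ∀ s ∈ Ico r₀ R, 0 ≤ slope n a p v s - w₀ := fun s hs =>
    sub_nonneg.2 (hmono ⟨h0.le, hr₀⟩ ⟨h0.le.trans hs.1, hs.2⟩ hs.1)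
  have hw₀0 : 0 ≤ w₀ := slope_nonneg hv.pos ⟨h0.le, hr₀⟩
  have hrp : ∀ s ∈ Ioo r₀ R, deriv (slope n a p v) s / R ^ a ≤ v s ^ p := by
    intro s hs
    have hv0 := hv.pos s ⟨(h0.trans hs.1).le, hs.2⟩
    rw [div_le_iff₀ hRa]
    have h2 : s ^ a ≤ R ^ a := Real.rpow_le_rpow (h0.trans hs.1).le hs.2.le D.ha
    calc _ ≤ s ^ a * v s ^ p := (hv.deriv_slope_bounds D ⟨h0.trans hs.1, hs.2⟩).2.2
      _ ≤ R ^ a * v s ^ p := by gcongr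
      _ = _ := mul_comm _ _
  choose! z' hz' hz'1 _ using fun s (hs : s ∈ Ioo 0 R) => hv.hasDerivAt_vel D hs
  -- Subtracting w₀ makes the left side vanish at r₀, so the nonnegative initial value of v' v^p can
  -- be discarded. This is why the constant does not depend on the solution; the shift inside h is
  -- harmless by monotonicity.
  have hvel : ∀ s ∈ Ico r₀ R, α * H h (slope n a p v s - w₀) ≤
      s * avg n (source n a b p h v) s * v s ^ p := by
    intro r hr
    have hsub : Icc r₀ r ⊆ Ico 0 R := Icc_subset_Ico_of_lt h0.le hr.2
    have hioo : ∀ s ∈ Ioo r₀ r, s ∈ Ioo 0 R := fun s hs => ⟨h0.trans hs.1, hs.2.trans hr.2⟩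
    have hcs := (continuousOn_slope (n := n) D.ha D.hp hv.cont).mono hsub
    have key := sub_le_sub_of_hasDerivAt_le (f := fun s => α * H h (slope n a p v s - w₀)) hr.1
      (continuousOn_const.mul ((continuous_H D.cont).comp_continuousOn
        (hcs.sub continuousOn_const)))
      (((hv.continuousOn_vel D).mono hsub).mul
        ((hv.cont.mono hsub).rpow_const fun _ _ => Or.inr hp.le))
      (fun s hs => ((hasDerivAt_H D.cont _).comp s
        ((hv.deriv_slope_bounds D (hioo s hs)).1.sub_const w₀)).const_mul α)
      (fun s hs => hv.hasDerivAt_vel_mul_rpow D (hioo s hs) (hz' s (hioo s hs))) (fun s hs => by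
        have hv0 := hv.pos s ⟨(h0.trans hs.1).le, hs.2.trans hr.2⟩
        have h1 := hz'1 s (hioo s hs)
        have h2 := hrp s ⟨hs.1, hs.2.trans hr.2⟩
        have h3 := (hv.deriv_slope_pos D (hioo s hs)).le
        have h4 : r₀ ^ b ≤ s ^ b := Real.rpow_le_rpow h0.le hs.1.le D.hb
        have h5 : h (slope n a p v s - w₀) ≤ h (slope n a p v s) := D.mono (by linarith)
        have h6 := D.nonneg (slope n a p v s - w₀)
        have h10 : 0 ≤ s ^ b := hrb.le.trans h4
        have h7 : r₀ ^ b * h (slope n a p v s - w₀) / (n + 1) ≤ z' s := le_trans (by gcongr) h1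
        have h8 : 0 ≤ p * v s ^ (p - 1) * (s * avg n (source n a b p h v) s) ^ 2 := by positivity
        calc _ = r₀ ^ b * h (slope n a p v s - w₀) / (n + 1) *
              (deriv (slope n a p v) s / R ^ a) := by rw [hα]; field_simp
          _ ≤ z' s * v s ^ p := by gcongr; exact le_trans (by positivity) h7
          _ ≤ _ := by linarith)
    have h9 : 0 ≤ r₀ * avg n (source n a b p h v) r₀ * v r₀ ^ p :=
      mul_nonneg (vel_nonneg D h0.le) (Real.rpow_nonneg (hv.pos _ ⟨h0.le, hr₀⟩).le _)
    simp only [Pi.mul_apply, ← hw₀, sub_self, H_zero, mul_zero] at key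
    linarith
  have hsub : Icc r₀ r ⊆ Ico 0 R := Icc_subset_Ico_of_lt h0.le hr.2
  have hioo : ∀ s ∈ Ioo r₀ r, s ∈ Ioo 0 R := fun s hs => ⟨h0.trans hs.1, hs.2.trans hr.2⟩
  have hcs := (continuousOn_slope (n := n) D.ha D.hp hv.cont).mono hsub
  have key := sub_le_sub_of_hasDerivAt_le (f := fun s => β * primPrim h (slope n a p v s - w₀)) hr.1
    (continuousOn_const.mul ((continuous_primPrim D.cont).comp_continuousOn
      (hcs.sub continuousOn_const)))
    ((hv.cont.mono hsub).rpow_const fun _ _ => Or.inr (show 0 ≤ 2 * p + 1 by positivity))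
    (fun s hs => ((hasDerivAt_primPrim D.cont _).comp s
      ((hv.deriv_slope_bounds D (hioo s hs)).1.sub_const w₀)).const_mul β)
    (fun s hs => hv.hasDerivAt_rpow D (hioo s hs)) (fun s hs => by
      have hs' : s ∈ Ioo r₀ R := ⟨hs.1, hs.2.trans hr.2⟩
      have hH := H_nonneg D (hy s ⟨hs'.1.le, hs'.2⟩)
      have h3 := (hv.deriv_slope_pos D (hioo s hs)).le
      have hv0 := hv.pos s ⟨(h0.trans hs.1).le, hs'.2⟩
      have h4 := hrp s hs'
      have h5 := hvel s ⟨hs'.1.le, hs'.2⟩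
      calc _ = (2 * p + 1) * (deriv (slope n a p v) s / R ^ a) *
            (α * H h (slope n a p v s - w₀)) := by rw [hβ]; ring
        _ ≤ _ := by gcongr)
  have hv0 := hv.pos r ⟨h0.le.trans hr.1, hr.2⟩
  have h9 : 0 ≤ v r₀ ^ (2 * p + 1) := Real.rpow_nonneg (hv.pos _ ⟨h0.le, hr₀⟩).le _
  simp only [← hw₀, sub_self, primPrim_zero, mul_zero] at key
  have h1 := denom_le_rpow D hv0.le hβ0.le (hy r hr)
    (show β * primPrim h (slope n a p v r - w₀) ≤ _ by linarith)
  have h2 : r₀ ^ a ≤ r ^ a := Real.rpow_le_rpow h0.le hr.1 D.ha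
  calc _ = r₀ ^ a / (n + 1) * (β ^ (p / (2 * p + 1)) * denom p h (slope n a p v r - w₀)) := by
        ring
    _ ≤ r₀ ^ a / (n + 1) * v r ^ p := by gcongr
    _ ≤ r ^ a / (n + 1) * v r ^ p := by gcongr
    _ = r ^ a * v r ^ p / (n + 1) := by ring
    _ ≤ _ := (hv.deriv_slope_bounds D ⟨h0.trans_le hr.1, hr.2⟩).2.1

end Estimates

lemma lintegral_Ioi_lt_top_iff {g : ℝ → ℝ} (hg : ContinuousOn g (Ioi 0))
    (h0 : ∀ s, 0 < s → 0 ≤ g s) :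
    (∫⁻ s in Ioi (1 : ℝ), ENNReal.ofReal (g s)) < ⊤ ↔ ∃ M, ∀ s, 1 ≤ s → ∫ t in (1 : ℝ)..s, g t ≤ M := by
  have hsub : Ioi (1 : ℝ) ⊆ Ioi 0 := Ioi_subset_Ioi zero_le_one
  have hc : ∀ s, ContinuousOn g (Icc 1 s) := fun s =>
    hg.mono fun t ht => zero_lt_one.trans_le ht.1
  have hmeas : AEStronglyMeasurable g (volume.restrict (Ioi 1)) :=
    (hg.mono hsub).aestronglyMeasurable measurableSet_Ioi
  have hae : 0 ≤ᵐ[volume.restrict (Ioi 1)] g :=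
    (ae_restrict_iff' measurableSet_Ioi).2 (ae_of_all _ fun s hs => h0 s (hsub hs))
  rw [lt_top_iff_ne_top, lintegral_ofReal_ne_top_iff_integrable hmeas hae]
  constructor
  · intro hi
    refine ⟨∫ t in Ioi 1, g t, fun s hs => ?_⟩
    rw [intervalIntegral.integral_of_le hs]
    exact setIntegral_mono_set hi hae (Ioc_subset_Ioi_self.eventuallyLE)
  · rintro ⟨M, hM⟩
    refine integrableOn_Ioi_of_intervalIntegral_norm_bounded (l := atTop) (b := id) M 1
      (fun s => (hc s).integrableOn_Icc.mono_set Ioc_subset_Icc_self) tendsto_id ?_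
    filter_upwards [eventually_ge_atTop 1] with s hs
    refine le_trans (le_of_eq (intervalIntegral.integral_congr fun t ht => ?_)) (hM s hs)
    rw [id, uIcc_of_le hs] at ht
    exact Real.norm_of_nonneg (h0 t (zero_lt_one.trans_le ht.1))

/-! ### Consequences of the integral conditions -/

section Weighted

variable {n : ℕ} {a b p R : ℝ} {h v : ℝ → ℝ}

/-- `Φₖ(s) = ∫₁ˢ tᵏ / denom(t) dt`. -/
noncomputable def prim (k : ℕ) (p : ℝ) (h : ℝ → ℝ) (s : ℝ) : ℝ :=
  ∫ t in (1 : ℝ)..s, t ^ k / denom p h t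

lemma continuousOn_integrand (k : ℕ) (D : Data a b p h) :
    ContinuousOn (fun t => t ^ k / denom p h t) (Ioi 0) :=
  (continuousOn_id.pow k).div (continuous_denom D).continuousOn fun _ ht => (denom_pos D ht).ne'

lemma integrand_nonneg (k : ℕ) (D : Data a b p h) (t : ℝ) (ht : 0 < t) :
    0 ≤ t ^ k / denom p h t := by
  have := denom_pos D ht
  positivity

lemma hasDerivAt_prim (k : ℕ) (D : Data a b p h) {s : ℝ} (hs : 0 < s) :
    HasDerivAt (prim k p h) (s ^ k / denom p h s) s := by
  have hc := continuousOn_integrand k D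
  refine intervalIntegral.integral_hasDerivAt_right (hc.mono fun t ht => ?_).intervalIntegrable
    (hc.stronglyMeasurableAtFilter isOpen_Ioi s hs) (hc.continuousAt (Ioi_mem_nhds hs))
  exact lt_of_lt_of_le (lt_min zero_lt_one hs) ht.1

lemma continuousOn_prim (k : ℕ) (D : Data a b p h) : ContinuousOn (prim k p h) (Ioi 0) :=
  fun _ hs => (hasDerivAt_prim k D hs).continuousAt.continuousWithinAt

lemma monotoneOn_prim (k : ℕ) (D : Data a b p h) : MonotoneOn (prim k p h) (Ioi 0) := by
  refine monotoneOn_of_deriv_nonneg (convex_Ioi 0) (continuousOn_prim k D) ?_ ?_ <;>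
    rw [interior_Ioi]
  · exact fun s hs => (hasDerivAt_prim k D hs).differentiableAt.differentiableWithinAt
  · intro s hs
    rw [(hasDerivAt_prim k D hs).deriv]
    exact integrand_nonneg k D s hs

lemma I₀_lt_top_iff (D : Data a b p h) : I₀ p h < ⊤ ↔ ∃ M, ∀ s, 1 ≤ s → prim 0 p h s ≤ M := by
  have := lintegral_Ioi_lt_top_iff (continuousOn_integrand 0 D) (integrand_nonneg 0 D)
  simpa only [I₀, prim, pow_zero] using this

lemma I₁_lt_top_iff (D : Data a b p h) : I₁ p h < ⊤ ↔ ∃ M, ∀ s, 1 ≤ s → prim 1 p h s ≤ M := by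
  have := lintegral_Ioi_lt_top_iff (continuousOn_integrand 1 D) (integrand_nonneg 1 D)
  simpa only [I₁, prim, pow_one] using this

lemma I₀_le_I₁ (D : Data a b p h) : I₀ p h ≤ I₁ p h := by
  refine setLIntegral_mono' measurableSet_Ioi fun s hs => ENNReal.ofReal_le_ofReal ?_
  have hs1 : (1 : ℝ) < s := hs
  have := denom_pos D (zero_lt_one.trans hs1)
  gcongr

lemma prim_le_of_bound (k : ℕ) (D : Data a b p h) {M : ℝ}
    (hM : ∀ s, 1 ≤ s → prim k p h s ≤ M) {s : ℝ} (hs : 0 < s) : prim k p h s ≤ M :=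
  (monotoneOn_prim k D hs (lt_of_lt_of_le hs (le_max_left s 1)) (le_max_left s 1)).trans
    (hM _ (le_max_right s 1))

namespace IsProfile

variable (D : Data a b p h) (hv : IsProfile n R a b p h v)
include D hv

/-- If w ≤ W throughout, the source is at most R^b h(W), so v' and hence v are bounded. -/
lemma exists_lt_slope (hunb : ∀ M, ∃ r ∈ Ico 0 R, M < v r) (W : ℝ) :
    ∃ r ∈ Ico 0 R, W < slope n a p v r := by
  by_contra! hW
  have hR : 0 < R := by
    obtain ⟨r, hr, -⟩ := hunb 0
    exact hr.1.trans_lt hr.2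
  obtain ⟨r, hr, hlt⟩ := hunb (v 0 + R * (R * (R ^ b * h W)))
  have hsrc : ∀ t ∈ Ico 0 R, source n a b p h v t ≤ R ^ b * h W := fun t ht =>
    mul_le_mul (Real.rpow_le_rpow ht.1 ht.2.le D.hb) (D.mono (hW t ht)) (D.nonneg _)
      (Real.rpow_nonneg hR.le _)
  have hK : 0 ≤ R ^ b * h W := mul_nonneg (Real.rpow_nonneg hR.le _) (D.nonneg _)
  have key := sub_le_sub_of_hasDerivAt_le (g := fun s => R * (R ^ b * h W) * s) hr.1
    (hv.cont.mono (Icc_subset_Ico_of_lt le_rfl hr.2)) (by fun_prop)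
    (fun s hs => hv.hasDerivAt D ⟨hs.1, hs.2.trans hr.2⟩)
    (fun s _ => (hasDerivAt_id s).const_mul _) (fun s hs => by
      have hsR := hs.2.trans hr.2
      have hsub : Icc 0 s ⊆ Ico 0 R := Icc_subset_Ico_of_lt le_rfl hsR
      have h1 := avg_le_of_le n hs.1.le ((continuousOn_source (n := n) D hv.cont).mono hsub)
        fun t ht => hsrc t (hsub ht)
      have h2 : 0 ≤ avg n (source n a b p h v) s :=
        avg_nonneg n hs.1.le fun t ht => source_nonneg D ht.1
      have h3 : avg n (source n a b p h v) s ≤ R ^ b * h W := by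
        have : (0 : ℝ) ≤ n * avg n (source n a b p h v) s := by positivity
        linarith
      rw [mul_one]
      exact mul_le_mul hsR.le h3 h2 hR.le)
  have h4 : R * (R ^ b * h W) * r ≤ R * (R ^ b * h W) * R := by
    have := hr.2.le; gcongr
  simp only [mul_zero, sub_zero] at key
  linarith

lemma hasDerivAt_newt_weight {r : ℝ} (hr : r ∈ Ioo 0 R) :
    HasDerivAt (newt n fun t => t ^ a * v t ^ p) (slope n a p v r) r :=
  hasDerivAt_newt_of_continuousOn n (continuousOn_weight D.ha D.hp hv.cont) hr

lemma monotoneOn_newt_weight : MonotoneOn (newt n fun t => t ^ a * v t ^ p) (Ico 0 R) := by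
  intro s hs t ht hst
  have := sub_le_sub_of_hasDerivAt_le (f := fun _ => 0) (f' := fun _ => 0) hst continuousOn_const
    ((continuousOn_newt n (continuousOn_weight D.ha D.hp hv.cont)).mono
      (Icc_subset_Ico_of_lt hs.1 ht.2)) (fun x _ => hasDerivAt_const x 0)
    (fun x hx => hv.hasDerivAt_newt_weight D ⟨hs.1.trans_lt hx.1, hx.2.trans ht.2⟩)
    (fun x hx => slope_nonneg hv.pos ⟨hs.1.trans hx.1.le, hx.2.trans ht.2⟩)
  linarith

/-- The potential of the weight is u up to an additive constant, with derivative w; a bound for w by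
the derivative of a bounded function near R suffices, and monotonicity covers earlier radii. -/
lemma bddAbove_newt_weight_of_slope {r₀ g₀ : ℝ} {g g' : ℝ → ℝ} (h0 : 0 < r₀) (hr₀ : r₀ < R)
    (hg : ∀ r ∈ Ico r₀ R, HasDerivAt g (g' r) r)
    (hle : ∀ r ∈ Ico r₀ R, slope n a p v r ≤ g' r) (hb : ∀ r ∈ Ico r₀ R, g r ≤ g₀) :
    ∃ M, ∀ r ∈ Ico 0 R, newt n (fun t => t ^ a * v t ^ p) r ≤ M := by
  have hlate : ∀ r ∈ Ico r₀ R, newt n (fun t => t ^ a * v t ^ p) r ≤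
      newt n (fun t => t ^ a * v t ^ p) r₀ + (g₀ - g r₀) := by
    intro r hr
    have := sub_le_sub_of_hasDerivAt_le (f := newt n fun t => t ^ a * v t ^ p) (g := g) hr.1
      ((continuousOn_newt n (continuousOn_weight D.ha D.hp hv.cont)).mono
        (Icc_subset_Ico_of_lt h0.le hr.2))
      (fun s hs => (hg s ⟨hs.1, hs.2.trans_lt hr.2⟩).continuousAt.continuousWithinAt)
      (fun x hx => hv.hasDerivAt_newt_weight D ⟨h0.trans hx.1, hx.2.trans hr.2⟩)
      (fun x hx => hg x ⟨hx.1.le, hx.2.trans hr.2⟩)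
      (fun x hx => hle x ⟨hx.1.le, hx.2.trans hr.2⟩)
    linarith [hb r hr]
  refine ⟨_, fun r hr => (hv.monotoneOn_newt_weight D hr ?_ (le_max_left r r₀)).trans
    (hlate (max r r₀) ⟨le_max_right _ _, max_lt hr.2 hr₀⟩)⟩
  exact ⟨hr.1.trans (le_max_left _ _), max_lt hr.2 hr₀⟩

/-- If `v` is bounded then so is `u`. -/
lemma bddAbove_newt_weight_of_bdd (hR : 0 < R) {M : ℝ} (hM : ∀ r ∈ Ico 0 R, v r ≤ M) :
    ∃ M, ∀ r ∈ Ico 0 R, newt n (fun t => t ^ a * v t ^ p) r ≤ M := by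
  have hM0 : 0 ≤ M := (hv.pos 0 ⟨le_rfl, hR⟩).le.trans (hM 0 ⟨le_rfl, hR⟩)
  have hK : 0 ≤ R ^ a * M ^ p := by positivity
  refine hv.bddAbove_newt_weight_of_slope D (r₀ := R / 2) (g₀ := R * (R ^ a * M ^ p) * R)
    (g := fun r => R * (R ^ a * M ^ p) * r) (half_pos hR) (half_lt_self hR)
    (fun r _ => (hasDerivAt_id r).const_mul _) (fun r hr => ?_) (fun r hr => ?_)
  · have hr0 : 0 ≤ r := (half_pos hR).le.trans hr.1
    have hsub : Icc 0 r ⊆ Ico 0 R := Icc_subset_Ico_of_lt le_rfl hr.2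
    have h1 := avg_le_of_le (M := R ^ a * M ^ p) n hr0
      ((continuousOn_weight D.ha D.hp hv.cont).mono hsub)
      fun t ht => mul_le_mul (Real.rpow_le_rpow ht.1 (hsub ht).2.le D.ha)
        (Real.rpow_le_rpow (hv.pos t (hsub ht)).le (hM t (hsub ht)) D.hp.le)
        (Real.rpow_nonneg (hv.pos t (hsub ht)).le _) (Real.rpow_nonneg hR.le _)
    have h2 : 0 ≤ avg n (fun t => t ^ a * v t ^ p) r :=
      avg_nonneg n hr0 fun t ht => weight_nonneg hv.pos t (hsub ht)
    have h3 : (0 : ℝ) ≤ n * avg n (fun t => t ^ a * v t ^ p) r := by positivity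
    rw [mul_one]
    exact mul_le_mul hr.2.le (by linarith) h2 hR.le
  · have := hr.2.le
    gcongr

/-- By the upper inequality, (Φₖ(w))' = wᵏ w' / denom(w) ≤ C wᵏ. It is applied with g(r) = r for k =
0 and with the potential giving u for k = 1. -/
lemma exists_prim_le (k : ℕ) {r₀ : ℝ} (h0 : 0 < r₀) (hr₀ : r₀ < R) :
    ∃ C, 0 < C ∧ ∀ g : ℝ → ℝ, (∀ r ∈ Ico r₀ R, HasDerivAt g (slope n a p v r ^ k) r) →
      ∀ r ∈ Ico r₀ R, prim k p h (slope n a p v r) - prim k p h (slope n a p v r₀) ≤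
        C * g r - C * g r₀ := by
  obtain ⟨C, hC0, hC⟩ := hv.exists_deriv_slope_le D h0 hr₀
  refine ⟨C, hC0, fun g hg r hr => ?_⟩
  have hd : ∀ s ∈ Ico r₀ R, HasDerivAt (fun s => prim k p h (slope n a p v s))
      (slope n a p v s ^ k / denom p h (slope n a p v s) * deriv (slope n a p v) s) s :=
    fun s hs => (hasDerivAt_prim k D (hv.slope_pos D ⟨h0.trans_le hs.1, hs.2⟩)).comp s
      (hv.deriv_slope_bounds D ⟨h0.trans_le hs.1, hs.2⟩).1
  refine sub_le_sub_of_hasDerivAt_le (f := fun s => prim k p h (slope n a p v s))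
    (g := fun s => C * g s) hr.1
    (fun s hs => (hd s ⟨hs.1, hs.2.trans_lt hr.2⟩).continuousAt.continuousWithinAt)
    (fun s hs => ((hg s ⟨hs.1, hs.2.trans_lt hr.2⟩).const_mul C).continuousAt.continuousWithinAt)
    (fun s hs => hd s ⟨hs.1.le, hs.2.trans hr.2⟩)
    (fun s hs => (hg s ⟨hs.1.le, hs.2.trans hr.2⟩).const_mul C) fun s hs => ?_
  have hw := hv.slope_pos D ⟨h0.trans hs.1, hs.2.trans hr.2⟩
  have hden := denom_pos D hw
  have h1 := hC s ⟨hs.1.le, hs.2.trans hr.2⟩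
  rw [div_mul_eq_mul_div, div_le_iff₀ hden]
  calc _ ≤ slope n a p v s ^ k * (C * denom p h (slope n a p v s)) := by gcongr
    _ = _ := by ring

/-- An unbounded v makes w exceed every level, so a bound for Φₖ along w bounds Φₖ itself. -/
lemma bddAbove_prim (hunb : ∀ M, ∃ r ∈ Ico 0 R, M < v r) (k : ℕ) {r₀ M : ℝ}
    (hr₀ : r₀ < R) (hM : ∀ r ∈ Ico r₀ R, prim k p h (slope n a p v r) ≤ M) (s : ℝ) (hs : 1 ≤ s) :
    prim k p h s ≤ M := by
  obtain ⟨r, hr, hrs⟩ := hv.exists_lt_slope D hunb s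
  have hm : max r r₀ ∈ Ico 0 R := ⟨hr.1.trans (le_max_left _ _), max_lt hr.2 hr₀⟩
  have h1 : s ≤ slope n a p v (max r r₀) :=
    hrs.le.trans ((hv.strictMonoOn_slope D).monotoneOn hr hm (le_max_left _ _))
  have hs0 := zero_lt_one.trans_le hs
  exact (monotoneOn_prim k D hs0 (hs0.trans_le h1) h1).trans
    (hM _ ⟨le_max_right _ _, hm.2⟩)

/-- An unbounded solution forces `I₀ < ∞`. -/
lemma I₀_lt_top (hR : 0 < R) (hunb : ∀ M, ∃ r ∈ Ico 0 R, M < v r) : I₀ p h < ⊤ := by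
  obtain ⟨C, hC0, hC⟩ := hv.exists_prim_le D 0 (half_pos hR) (half_lt_self hR)
  refine (I₀_lt_top_iff D).2 ⟨prim 0 p h (slope n a p v (R / 2)) + C * R,
    hv.bddAbove_prim D hunb 0 (half_lt_self hR) fun r hr => ?_⟩
  have h1 := hC id (fun r _ => by simpa using hasDerivAt_id r) r hr
  have h2 : C * r ≤ C * R := by have := hr.2.le; gcongr
  have h3 : 0 ≤ C * (R / 2) := by positivity
  simp only [id] at h1
  linarith

/-- A solution with `v` unbounded and `u` bounded forces `I₁ < ∞`. -/
lemma I₁_lt_top (hR : 0 < R) (hunb : ∀ M, ∃ r ∈ Ico 0 R, M < v r) {M : ℝ}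
    (hM : ∀ r ∈ Ico 0 R, newt n (fun t => t ^ a * v t ^ p) r ≤ M) : I₁ p h < ⊤ := by
  obtain ⟨C, hC0, hC⟩ := hv.exists_prim_le D 1 (half_pos hR) (half_lt_self hR)
  refine (I₁_lt_top_iff D).2 ⟨prim 1 p h (slope n a p v (R / 2)) +
    (C * M - C * newt n (fun t => t ^ a * v t ^ p) (R / 2)),
    hv.bddAbove_prim D hunb 1 (half_lt_self hR) fun r hr => ?_⟩
  have h1 := hC (newt n fun t => t ^ a * v t ^ p) (fun r hr => by
    rw [pow_one]
    exact hv.hasDerivAt_newt_weight D ⟨(half_pos hR).trans_le hr.1, hr.2⟩) r hr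
  have h2 := mul_le_mul_of_nonneg_left (hM r ⟨(half_pos hR).le.trans hr.1, hr.2⟩) hC0.le
  linarith

end IsProfile

/-- Along every solution, `Φₖ(w - w(r₀))` grows at least like `c ∫ (w - w(r₀))ᵏ`. -/
lemma exists_mul_le_deriv_prim (n k : ℕ) (D : Data a b p h) {r₀ : ℝ} (h0 : 0 < r₀) (hr₀ : r₀ < R) :
    ∃ c, 0 < c ∧ ∀ v, IsProfile n R a b p h v → ∀ r ∈ Ioo r₀ R, ∃ d,
      HasDerivAt (fun s => prim k p h (slope n a p v s - slope n a p v r₀)) d r ∧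
      c * (slope n a p v r - slope n a p v r₀) ^ k ≤ d ∧
      0 < slope n a p v r - slope n a p v r₀ := by
  obtain ⟨c, hc0, hc⟩ := exists_le_deriv_slope n D h0 hr₀
  refine ⟨c, hc0, fun v hv r hr => ?_⟩
  have hr' : r ∈ Ioo 0 R := ⟨h0.trans hr.1, hr.2⟩
  have hy : 0 < slope n a p v r - slope n a p v r₀ :=
    sub_pos.2 (hv.strictMonoOn_slope D ⟨h0.le, hr₀⟩ ⟨hr'.1.le, hr.2⟩ hr.1)
  have hd : HasDerivAt (fun s => prim k p h (slope n a p v s - slope n a p v r₀)) _ r :=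
    HasDerivAt.comp (h := fun s => slope n a p v s - slope n a p v r₀) r (hasDerivAt_prim k D hy)
      ((hv.deriv_slope_bounds D hr').1.sub_const _)
  refine ⟨_, hd, ?_, hy⟩
  have hden := denom_pos D hy
  have h1 := hc v hv r ⟨hr.1.le, hr.2⟩
  rw [div_mul_eq_mul_div, le_div_iff₀ hden]
  calc _ = (slope n a p v r - slope n a p v r₀) ^ k *
        (c * denom p h (slope n a p v r - slope n a p v r₀)) := by ring
    _ ≤ _ := by gcongr

/-- If `I₁ < ∞`, then `u` is bounded. -/
lemma IsProfile.bddAbove_newt_weight (D : Data a b p h) (hv : IsProfile n R a b p h v)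
    (hR : 0 < R) (hI : I₁ p h < ⊤) :
    ∃ M, ∀ r ∈ Ico 0 R, newt n (fun t => t ^ a * v t ^ p) r ≤ M := by
  obtain ⟨M, hM⟩ := (I₁_lt_top_iff D).1 hI
  -- The shift is taken at R / 3 and the estimate starts at R / 2, so the shifted slope is strictly
  -- positive there, where Φ₁ is differentiable.
  have h3 : R / 3 < R / 2 := by linarith
  obtain ⟨c, hc0, hc⟩ := exists_mul_le_deriv_prim n 1 D (show 0 < R / 3 by positivity)
    (show R / 3 < R by linarith)
  choose! d hd hdc hpos using hc v hv
  set w₀ := slope n a p v (R / 3) with hw₀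
  have hw₀0 : 0 ≤ w₀ := (hv.slope_pos D ⟨by positivity, by linarith⟩).le
  have hmem : ∀ r ∈ Ico (R / 2) R, r ∈ Ioo (R / 3) R := fun r hr => ⟨h3.trans_le hr.1, hr.2⟩
  refine hv.bddAbove_newt_weight_of_slope D (r₀ := R / 2) (g₀ := c⁻¹ * M + w₀ * R)
    (g := fun r => c⁻¹ * prim 1 p h (slope n a p v r - w₀) + w₀ * r) (half_pos hR)
    (half_lt_self hR)
    (fun r hr => ((hd r (hmem r hr)).const_mul _).add ((hasDerivAt_id r).const_mul _))
    (fun r hr => ?_) (fun r hr => ?_)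
  · have h1 := mul_le_mul_of_nonneg_left (hdc r (hmem r hr)) (inv_pos.2 hc0).le
    rw [pow_one, inv_mul_cancel_left₀ hc0.ne'] at h1
    linarith
  · have h1 := prim_le_of_bound 1 D hM (hpos r (hmem r hr))
    have h2 := hr.2.le
    gcongr

/-- Interior bound of Keller–Osserman type for `w`, uniform over all solutions. -/
lemma exists_slope_le (n : ℕ) (D : Data a b p h) (hI : I₀ p h < ⊤) {r : ℝ} (hr : r ∈ Ioo 0 R) :
    ∃ K, ∀ v, IsProfile n R a b p h v → slope n a p v r ≤ K := by
  obtain ⟨M, hM⟩ := (I₀_lt_top_iff D).1 hI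
  have hr2 : r / 2 < r := half_lt_self hr.1
  obtain ⟨c, hc0, hc⟩ := exists_mul_le_deriv_prim n 0 D (half_pos hr.1) (hr2.trans hr.2)
  set S := {x | ∃ s, 1 ≤ s ∧ prim 0 p h s = x} with hS
  have hne : S.Nonempty := ⟨_, 1, le_rfl, rfl⟩
  have hbdd : BddAbove S := ⟨M, by rintro _ ⟨s, hs, rfl⟩; exact hM s hs⟩
  set ρ := (r + R) / 2 with hρ
  have hrρ : r < ρ := by linarith [hr.2]
  have hρR : ρ < R := by linarith [hr.2]
  have hδ : 0 < c * (ρ - r) := mul_pos hc0 (sub_pos.2 hrρ)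
  -- Beyond T, Φ₀ can grow by less than c (ρ - r), yet along any solution it grows by at least that
  -- much on [r, ρ]. Hence w(r) - w(r/2) < T.
  obtain ⟨_, ⟨T, hT, rfl⟩, hlt⟩ := exists_lt_of_lt_csSup hne (sub_lt_self (sSup S) hδ)
  refine ⟨2 * T, fun v hv => ?_⟩
  choose! d hd hdc hpos using hc v hv
  have key := sub_le_sub_of_hasDerivAt_le (f := fun s => c * s)
    (g := fun s => prim 0 p h (slope n a p v s - slope n a p v (r / 2))) hrρ.le (by fun_prop)
    (fun s hs => (hd s ⟨hr2.trans_le hs.1, hs.2.trans_lt hρR⟩).continuousAt.continuousWithinAt)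
    (fun s _ => (hasDerivAt_id s).const_mul c)
    (fun s hs => hd s ⟨hr2.trans hs.1, hs.2.trans hρR⟩)
    (fun s hs => by simpa using hdc s ⟨hr2.trans hs.1, hs.2.trans hρR⟩)
  have h1 : prim 0 p h (slope n a p v ρ - slope n a p v (r / 2)) ≤ sSup S :=
    prim_le_of_bound 0 D (fun s hs => le_csSup hbdd ⟨s, hs, rfl⟩)
      (hpos ρ ⟨hr2.trans hrρ, hρR⟩)
  have h2 : slope n a p v r - slope n a p v (r / 2) < T := by
    by_contra! hle
    have := monotoneOn_prim 0 D (zero_lt_one.trans_le hT) (hpos r ⟨hr2, hr.2⟩) hle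
    linarith
  have hsub : Icc 0 r ⊆ Ico 0 R := Icc_subset_Ico_of_lt le_rfl hr.2
  have h3 : avg n (fun t => t ^ a * v t ^ p) (r / 2) ≤ avg n (fun t => t ^ a * v t ^ p) r :=
    avg_mono n (half_pos hr.1).le hr2.le ((continuousOn_weight D.ha D.hp hv.cont).mono hsub)
      ((monotoneOn_weight D.ha D.hp (hv.monotoneOn D) hv.pos).mono hsub)
  -- The average is nondecreasing in the radius, so w(r/2) ≤ w(r)/2 and w(r) ≤ 2 (w(r) - w(r/2)).
  -- This removes the shift.
  have h4 : slope n a p v (r / 2) ≤ slope n a p v r / 2 := by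
    have := mul_le_mul_of_nonneg_left h3 (half_pos hr.1).le
    simp only [slope]
    linarith
  linarith

/-- Interior bound for `v`, uniform over all solutions. -/
lemma exists_profile_le (n : ℕ) (D : Data a b p h) (hI : I₀ p h < ⊤) {r : ℝ} (hr : r ∈ Ioo 0 R) :
    ∃ K, ∀ v, IsProfile n R a b p h v → ∀ s ∈ Icc 0 r, v s ≤ K := by
  set ρ := (r + R) / 2 with hρ
  have hrρ : r < ρ := by linarith [hr.2]
  have hρR : ρ < R := by linarith [hr.2]
  have hp := D.hp
  obtain ⟨K, hK⟩ := exists_slope_le n D hI (R := R) (r := ρ) ⟨hr.1.trans hrρ, hρR⟩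
  have hra : 0 < r ^ a := Real.rpow_pos_of_pos hr.1 a
  refine ⟨((n + 1) * K / (r ^ a * (ρ - r))) ^ p⁻¹, fun v hv s hs => ?_⟩
  have hrI : r ∈ Ico 0 R := ⟨hr.1.le, hr.2⟩
  have hv0 := hv.pos r hrI
  refine (hv.monotoneOn D ⟨hs.1, hs.2.trans_lt hr.2⟩ hrI hs.2).trans ?_
  have hsub : Icc r ρ ⊆ Ico 0 R := Icc_subset_Ico_of_lt hr.1.le hρR
  -- On [r, ρ] the slope has derivative at least r^a v(r)^p / (n + 1), so the bound for w(ρ) bounds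
  -- v(r).
  have key := sub_le_sub_of_hasDerivAt_le (f := fun s => r ^ a * v r ^ p / (n + 1) * s) hrρ.le
    (by fun_prop) ((continuousOn_slope (n := n) D.ha D.hp hv.cont).mono hsub)
    (fun s _ => (hasDerivAt_id s).const_mul _)
    (fun s hs => (hv.deriv_slope_bounds D ⟨hr.1.trans hs.1, hs.2.trans hρR⟩).1)
    (fun s hs => by
      have hs' : s ∈ Ico 0 R := ⟨(hr.1.trans hs.1).le, hs.2.trans hρR⟩
      refine le_trans ?_ (hv.deriv_slope_bounds D ⟨hr.1.trans hs.1, hs'.2⟩).2.1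
      have h1 := hr.1
      have h2 := hs.1.le
      have h3 := D.ha
      have h4 := hv.monotoneOn D hrI hs' hs.1.le
      have h5 := (Real.rpow_pos_of_pos (hr.1.trans hs.1) a).le
      rw [mul_one]
      gcongr)
  have h1 := hK v hv
  have h2 : 0 ≤ slope n a p v r := slope_nonneg hv.pos hrI
  have h3 : v r ^ p ≤ (n + 1) * K / (r ^ a * (ρ - r)) := by
    have hρr := sub_pos.2 hrρ
    rw [le_div_iff₀ (by positivity)]
    have h4 : r ^ a * v r ^ p / (n + 1) * (ρ - r) ≤ K := by linarith
    rw [div_mul_eq_mul_div, div_le_iff₀ (by positivity)] at h4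
    linarith
  calc v r = (v r ^ p) ^ p⁻¹ := by rw [← Real.rpow_mul hv0.le, mul_inv_cancel₀ hp.ne', Real.rpow_one]
    _ ≤ _ := Real.rpow_le_rpow (by positivity) h3 (by positivity)

end Weighted

/-! ### Locality and continuity of the integral operator -/

section Congr

variable {n : ℕ} {a b p : ℝ} {h v w : ℝ → ℝ}

lemma slope_congr {r : ℝ} (hr : 0 ≤ r) (hvw : EqOn v w (Icc 0 r)) :
    slope n a p v r = slope n a p w r := by
  have he : EqOn (fun t => t ^ a * v t ^ p) (fun t => t ^ a * w t ^ p) (Icc 0 r) := fun t ht => by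
    simp only [hvw ht]
  rw [slope, slope, avg_congr n hr he]

lemma source_congr {r : ℝ} (hvw : EqOn v w (Icc 0 r)) :
    EqOn (source n a b p h v) (source n a b p h w) (Icc 0 r) := fun t ht => by
  rw [source, source, slope_congr ht.1 (hvw.mono (Icc_subset_Icc_right ht.2))]

lemma newt_source_congr {r : ℝ} (hr : 0 ≤ r) (hvw : EqOn v w (Icc 0 r)) :
    newt n (source n a b p h v) r = newt n (source n a b p h w) r :=
  newt_congr n hr (source_congr hvw)

lemma continuous_weight (D : Data a b p h) (hv : Continuous v) :
    Continuous fun t => t ^ a * v t ^ p :=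
  (continuous_id.rpow_const fun _ => Or.inr D.ha).mul (hv.rpow_const fun _ => Or.inr D.hp.le)

lemma continuous_slope (D : Data a b p h) (hv : Continuous v) : Continuous (slope n a p v) :=
  continuous_id.mul (continuous_avg n (continuous_weight D hv))

lemma continuous_source (D : Data a b p h) (hv : Continuous v) :
    Continuous (source n a b p h v) :=
  (continuous_id.rpow_const fun _ => Or.inr D.hb).mul (D.cont.comp (continuous_slope D hv))

lemma monotoneOn_newt_source (D : Data a b p h) (hv : Continuous v) :
    MonotoneOn (newt n (source n a b p h v)) (Ici 0) := by
  intro s hs t _ hst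
  have := sub_le_sub_of_hasDerivAt_le (f := fun _ => 0) (f' := fun _ => 0) hst continuousOn_const
    (continuous_newt n (continuous_source (n := n) D hv)).continuousOn
    (fun x _ => hasDerivAt_const x 0)
    (fun x _ => hasDerivAt_newt n (continuous_source D hv) x)
    (fun x hx => vel_nonneg D (le_trans hs hx.1.le))
  linarith

end Congr

/-! ### The truncated operator as a contraction -/

section Lipschitz

lemma abs_avg_sub_le (n : ℕ) {f g : ℝ → ℝ} {r M : ℝ} (hr : 0 ≤ r) (hf : ContinuousOn f (Icc 0 r))
    (hg : ContinuousOn g (Icc 0 r)) (hM : ∀ t ∈ Icc 0 r, |f t - g t| ≤ M) :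
    |avg n f r - avg n g r| ≤ M := by
  have h0 : 0 ≤ M := (abs_nonneg _).trans (hM 0 ⟨le_rfl, hr⟩)
  rw [avg, avg, ← intervalIntegral.integral_sub (intervalIntegrable_avg n hr hf)
    (intervalIntegrable_avg n hr hg)]
  have := intervalIntegral.norm_integral_le_of_norm_le_const (a := 0) (b := 1) (C := M)
    (f := fun σ => σ ^ n * f (r * σ) - σ ^ n * g (r * σ)) fun σ hσ => by
      rw [uIoc_of_le zero_le_one] at hσ
      rw [← mul_sub, Real.norm_eq_abs, abs_mul, abs_of_nonneg (pow_nonneg hσ.1.le n)]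
      have h1 : σ ^ n ≤ 1 := pow_le_one₀ hσ.1.le hσ.2
      have h2 := hM _ (mul_mem_Icc_of_unit hr ⟨hσ.1.le, hσ.2⟩)
      calc _ ≤ 1 * M := mul_le_mul h1 h2 (abs_nonneg _) zero_le_one
        _ = M := one_mul M
  simpa using this

lemma exists_lipschitz_of_hasDerivWithinAt {f f' : ℝ → ℝ} {α β : ℝ}
    (hf : ∀ x ∈ Icc α β, HasDerivWithinAt f (f' x) (Icc α β) x)
    (hc : ContinuousOn f' (Icc α β)) :
    ∃ K, 0 ≤ K ∧ ∀ x ∈ Icc α β, ∀ y ∈ Icc α β, |f x - f y| ≤ K * |x - y| := by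
  obtain ⟨K, hK⟩ := isCompact_Icc.exists_bound_of_continuousOn hc
  refine ⟨max K 0, le_max_right _ _, fun x hx y hy => ?_⟩
  exact Convex.norm_image_sub_le_of_norm_hasDerivWithin_le (C := max K 0) hf
    (fun z hz => (hK z hz).trans (le_max_left _ _)) (convex_Icc α β) hy hx

lemma exists_lipschitz_rpow (p : ℝ) {c L : ℝ} (hc : 0 < c) :
    ∃ K, 0 ≤ K ∧ ∀ x ∈ Icc c L, ∀ y ∈ Icc c L, |x ^ p - y ^ p| ≤ K * |x - y| :=
  exists_lipschitz_of_hasDerivWithinAt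
    (fun _ hx => (Real.hasDerivAt_rpow_const (Or.inl (hc.trans_le hx.1).ne')).hasDerivWithinAt)
    (continuousOn_const.mul (continuousOn_id.rpow_const
      fun _ hx => Or.inl (hc.trans_le hx.1).ne'))

/-- Truncation of a real number to `[c, L]`. -/
def trunc (c L x : ℝ) : ℝ := max c (min L x)

lemma trunc_mem {c L : ℝ} (hcL : c ≤ L) (x : ℝ) : trunc c L x ∈ Icc c L :=
  ⟨le_max_left _ _, max_le hcL (min_le_left _ _)⟩

lemma trunc_eq {c L x : ℝ} (h1 : c ≤ x) (h2 : x ≤ L) : trunc c L x = x := by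
  simp [trunc, h1, h2]

lemma abs_trunc_sub_le (c L x y : ℝ) : |trunc c L x - trunc c L y| ≤ |x - y| := by
  have h1 := abs_max_sub_max_le_max c (min L x) c (min L y)
  have h2 := abs_min_sub_min_le_max L x L y
  simp only [sub_self, abs_zero] at h1 h2
  rw [max_eq_right (abs_nonneg (min L x - min L y))] at h1
  rw [max_eq_right (abs_nonneg (x - y))] at h2
  exact h1.trans h2

lemma continuous_trunc {c L : ℝ} {y : ℝ → ℝ} (hy : Continuous y) :
    Continuous fun t => trunc c L (y t) := by
  unfold trunc; fun_prop

variable {n : ℕ} {a b p R c₀ L : ℝ} {h : ℝ → ℝ}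

/-- The integral operator of the truncated system. -/
noncomputable def truncOp (n : ℕ) (a b p : ℝ) (h : ℝ → ℝ) (c₀ L : ℝ) (y : ℝ → ℝ) : ℝ → ℝ :=
  newt n (source n a b p h fun t => trunc c₀ L (y t))

/-- The truncated operator is a contraction for an exponentially weighted supremum norm, on every
interval `[0, ρ] ⊆ [0, R]`. -/
lemma exists_truncOp_contraction (n : ℕ) (D : Data a b p h)
    (hlip : ∀ W, ∃ K, 0 ≤ K ∧ ∀ x ∈ Icc 0 W, ∀ y ∈ Icc 0 W, |h x - h y| ≤ K * |x - y|)
    (hR : 0 < R) (hc₀ : 0 < c₀) (hL : c₀ ≤ L) :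
    ∃ Λ, 0 < Λ ∧ ∀ y₁ y₂ : ℝ → ℝ, Continuous y₁ → Continuous y₂ → ∀ ρ ≤ R, ∀ δ, 0 ≤ δ →
      (∀ s ∈ Icc 0 ρ, |y₁ s - y₂ s| ≤ δ * Real.exp (Λ * s)) → ∀ r ∈ Icc 0 ρ,
        |truncOp n a b p h c₀ L y₁ r - truncOp n a b p h c₀ L y₂ r| ≤
          δ / 2 * Real.exp (Λ * r) := by
  obtain ⟨Kp, hKp0, hKp⟩ := exists_lipschitz_rpow p (L := L) hc₀
  -- The slope of a function with values in [c₀, L] stays in [0, R · R^a L^p], so a local Lipschitz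
  -- constant of h suffices. Similarly c₀ > 0 makes x ↦ x^p Lipschitz even for p < 1.
  obtain ⟨Kh, hKh0, hKh⟩ := hlip (R * (R ^ a * L ^ p))
  have hL0 : 0 < L := hc₀.trans_le hL
  have hRa : 0 < R ^ a := Real.rpow_pos_of_pos hR a
  have hRb : 0 < R ^ b := Real.rpow_pos_of_pos hR b
  set C := R ^ b * (Kh * (R * (R ^ a * Kp))) with hC
  have hC0 : 0 ≤ C := by positivity
  -- Integrating R C δ e^(Λ t) gains a factor 1/Λ, and this Λ makes R C / Λ ≤ 1/2.
  set Λ := 2 * (R * C) + 1 with hΛ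
  have hΛ0 : 0 < Λ := by positivity
  refine ⟨Λ, hΛ0, fun y₁ y₂ hy₁ hy₂ ρ hρ δ hδ hy r hr => ?_⟩
  have hexp : ∀ s t : ℝ, s ≤ t → Real.exp (Λ * s) ≤ Real.exp (Λ * t) := fun s t hst =>
    Real.exp_le_exp.2 (mul_le_mul_of_nonneg_left hst hΛ0.le)
  set x₁ : ℝ → ℝ := fun t => trunc c₀ L (y₁ t) with hx₁
  set x₂ : ℝ → ℝ := fun t => trunc c₀ L (y₂ t) with hx₂
  have hcx₁ : Continuous x₁ := continuous_trunc hy₁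
  have hcx₂ : Continuous x₂ := continuous_trunc hy₂
  have hweight : ∀ t ∈ Icc 0 ρ, |t ^ a * x₁ t ^ p - t ^ a * x₂ t ^ p| ≤
      R ^ a * Kp * δ * Real.exp (Λ * t) := by
    intro t ht
    have h1 := hKp _ (trunc_mem hL (y₁ t)) _ (trunc_mem hL (y₂ t))
    have h2 := (abs_trunc_sub_le c₀ L (y₁ t) (y₂ t)).trans (hy t ht)
    have h3 : t ^ a ≤ R ^ a := Real.rpow_le_rpow ht.1 (ht.2.trans hρ) D.ha
    have h4 : 0 ≤ t ^ a := Real.rpow_nonneg ht.1 a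
    rw [← mul_sub, abs_mul, abs_of_nonneg h4]
    calc t ^ a * |x₁ t ^ p - x₂ t ^ p| ≤ R ^ a * (Kp * (δ * Real.exp (Λ * t))) := by
          refine mul_le_mul h3 (h1.trans (by gcongr)) (abs_nonneg _) hRa.le
      _ = _ := by ring
  have hslope : ∀ t ∈ Icc 0 ρ, |slope n a p x₁ t - slope n a p x₂ t| ≤
      R * (R ^ a * Kp * δ * Real.exp (Λ * t)) := by
    intro t ht
    have h1 := abs_avg_sub_le n ht.1 (continuous_weight D hcx₁).continuousOn
      (continuous_weight D hcx₂).continuousOn (M := R ^ a * Kp * δ * Real.exp (Λ * t))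
      fun s hs => (hweight s ⟨hs.1, hs.2.trans ht.2⟩).trans (by
        have := hexp s t hs.2
        gcongr)
    rw [slope, slope, ← mul_sub, abs_mul, abs_of_nonneg ht.1]
    exact mul_le_mul (ht.2.trans hρ) h1 (abs_nonneg _) hR.le
  have hrange : ∀ y : ℝ → ℝ, Continuous y → ∀ t ∈ Icc 0 ρ,
      slope n a p (fun t => trunc c₀ L (y t)) t ∈ Icc 0 (R * (R ^ a * L ^ p)) := by
    intro y hyc t ht
    have hx : ∀ s ∈ Icc 0 t, 0 ≤ s ^ a * trunc c₀ L (y s) ^ p := fun s hs =>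
      mul_nonneg (Real.rpow_nonneg hs.1 _)
        (Real.rpow_nonneg (hc₀.le.trans (trunc_mem hL (y s)).1) _)
    have h1 := avg_nonneg n ht.1 hx
    have h2 := avg_le_of_le (M := R ^ a * L ^ p) n ht.1
      (continuous_weight D (continuous_trunc (c := c₀) (L := L) hyc)).continuousOn fun s hs =>
      mul_le_mul (Real.rpow_le_rpow hs.1 (hs.2.trans (ht.2.trans hρ)) D.ha)
        (Real.rpow_le_rpow (hc₀.le.trans (trunc_mem hL (y s)).1) (trunc_mem hL (y s)).2 D.hp.le)
        (Real.rpow_nonneg (hc₀.le.trans (trunc_mem hL (y s)).1) _) hRa.le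
    have h3 : (0 : ℝ) ≤ n * avg n (fun s => s ^ a * trunc c₀ L (y s) ^ p) t := by positivity
    exact ⟨mul_nonneg ht.1 h1, mul_le_mul (ht.2.trans hρ) (by linarith) h1 hR.le⟩
  have hsource : ∀ t ∈ Icc 0 ρ, |source n a b p h x₁ t - source n a b p h x₂ t| ≤
      C * δ * Real.exp (Λ * t) := by
    intro t ht
    have h1 := hKh _ (hrange y₁ hy₁ t ht) _ (hrange y₂ hy₂ t ht)
    have h2 := hslope t ht
    have h3 : t ^ b ≤ R ^ b := Real.rpow_le_rpow ht.1 (ht.2.trans hρ) D.hb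
    have h4 : 0 ≤ t ^ b := Real.rpow_nonneg ht.1 b
    rw [source, source, ← mul_sub, abs_mul, abs_of_nonneg h4]
    calc _ ≤ R ^ b * (Kh * (R * (R ^ a * Kp * δ * Real.exp (Λ * t)))) := by
          refine mul_le_mul h3 (h1.trans ?_) (abs_nonneg _) hRb.le
          exact mul_le_mul_of_nonneg_left h2 hKh0
      _ = _ := by rw [hC]; ring
  have hcs₁ := continuous_source (n := n) D hcx₁
  have hcs₂ := continuous_source (n := n) D hcx₂
  have hvel : ∀ t ∈ Icc 0 ρ, |t * avg n (source n a b p h x₁) t -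
      t * avg n (source n a b p h x₂) t| ≤ R * (C * δ * Real.exp (Λ * t)) := by
    intro t ht
    have h1 := abs_avg_sub_le n ht.1 hcs₁.continuousOn hcs₂.continuousOn
      (M := C * δ * Real.exp (Λ * t))
      fun s hs => (hsource s ⟨hs.1, hs.2.trans ht.2⟩).trans (by
        have := hexp s t hs.2
        gcongr)
    rw [← mul_sub, abs_mul, abs_of_nonneg ht.1]
    exact mul_le_mul (ht.2.trans hρ) h1 (abs_nonneg _) hR.le
  have hexpd : ∀ t, HasDerivAt (fun t => R * (C * δ) / Λ * Real.exp (Λ * t))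
      (R * (C * δ * Real.exp (Λ * t))) t := fun t => by
    refine (((hasDerivAt_id t).const_mul Λ).exp.const_mul (R * (C * δ) / Λ)).congr_deriv ?_
    simp only [id]
    field_simp
  have hnd : ∀ t, HasDerivAt (fun t => newt n (source n a b p h x₁) t -
      newt n (source n a b p h x₂) t) (t * avg n (source n a b p h x₁) t -
      t * avg n (source n a b p h x₂) t) t := fun t =>
    (hasDerivAt_newt n hcs₁ t).sub (hasDerivAt_newt n hcs₂ t)
  have hcont : ∀ {f f' : ℝ → ℝ}, (∀ t, HasDerivAt f (f' t) t) → ContinuousOn f (Icc 0 r) :=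
    fun hf t _ => (hf t).continuousAt.continuousWithinAt
  have hmem : ∀ t ∈ Ioo 0 r, t ∈ Icc 0 ρ := fun t ht => ⟨ht.1.le, ht.2.le.trans hr.2⟩
  have key1 := sub_le_sub_of_hasDerivAt_le hr.1 (hcont hnd) (hcont hexpd) (fun t _ => hnd t)
    (fun t _ => hexpd t) fun t ht => (abs_le.1 (hvel t (hmem t ht))).2
  have key2 := sub_le_sub_of_hasDerivAt_le hr.1 (hcont fun t => (hnd t).neg) (hcont hexpd)
    (fun t _ => (hnd t).neg) (fun t _ => hexpd t)
    fun t ht => neg_le.1 (abs_le.1 (hvel t (hmem t ht))).1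
  have h0 : 0 ≤ R * (C * δ) / Λ := by positivity
  have hle : R * (C * δ) / Λ ≤ δ / 2 := by
    rw [div_le_iff₀ hΛ0, hΛ]; nlinarith
  have hfin := mul_le_mul_of_nonneg_right hle (Real.exp_pos (Λ * r)).le
  simp only [Pi.neg_apply, newt_zero, mul_zero, Real.exp_zero, sub_self, neg_zero, mul_one,
    sub_zero] at key1 key2
  rw [truncOp, truncOp, abs_le]
  constructor <;> linarith

end Lipschitz

/-! ### Solvability and continuous dependence for the truncated system -/

section Family

variable {n : ℕ} {a b p R c₀ L : ℝ} {h : ℝ → ℝ}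

lemma continuous_truncOp (D : Data a b p h) {y : ℝ → ℝ} (hy : Continuous y) :
    Continuous (truncOp n a b p h c₀ L y) :=
  continuous_newt n (continuous_source D (continuous_trunc hy))

/-- The truncated system has a solution for every initial value. -/
lemma exists_truncOp_fixed (n : ℕ) (D : Data a b p h)
    (hlip : ∀ W, ∃ K, 0 ≤ K ∧ ∀ x ∈ Icc 0 W, ∀ y ∈ Icc 0 W, |h x - h y| ≤ K * |x - y|)
    (hR : 0 < R) (hc₀ : 0 < c₀) (hL : c₀ ≤ L) (c : ℝ) :
    ∃ y : ℝ → ℝ, Continuous y ∧ ∀ r ∈ Icc 0 R, y r = c + truncOp n a b p h c₀ L y r := by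
  obtain ⟨Λ, -, hΛ⟩ := exists_truncOp_contraction n D hlip hR hc₀ hL
  -- Writing y = e^(Λ t) η turns the weighted norm into the ordinary supremum norm of η.
  let lift : C(Icc (0 : ℝ) R, ℝ) → ℝ → ℝ := fun η t =>
    Real.exp (Λ * t) * IccExtend hR.le η t
  have hlift : ∀ η, Continuous (lift η) := fun η => by
    have : Continuous (IccExtend hR.le η) := η.continuous.Icc_extend'
    fun_prop
  have hliftval : ∀ η (t : ℝ) (ht : t ∈ Icc 0 R), lift η t = Real.exp (Λ * t) * η ⟨t, ht⟩ :=
    fun η t ht => by simp only [lift, IccExtend_of_mem hR.le η ht]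
  let F : C(Icc (0 : ℝ) R, ℝ) → C(Icc (0 : ℝ) R, ℝ) := fun η =>
    ⟨fun t => Real.exp (-(Λ * t)) * (c + truncOp n a b p h c₀ L (lift η) t), by
      have := continuous_truncOp (n := n) (c₀ := c₀) (L := L) D (hlift η)
      fun_prop⟩
  have hF : ContractingWith (1 / 2) F := by
    refine ⟨by norm_num, LipschitzWith.of_dist_le_mul fun η₁ η₂ => ?_⟩
    rw [ContinuousMap.dist_le (by positivity)]
    rintro ⟨t, ht⟩
    have h1 := hΛ (lift η₁) (lift η₂) (hlift _) (hlift _) R le_rfl (dist η₁ η₂) dist_nonneg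
      (fun s hs => by
        rw [hliftval _ s hs, hliftval _ s hs, ← mul_sub, abs_mul, Real.abs_exp, mul_comm,
          ← Real.dist_eq]
        exact mul_le_mul_of_nonneg_right (ContinuousMap.dist_apply_le_dist _)
          (Real.exp_pos _).le) t ht
    have h2 : dist (F η₁ ⟨t, ht⟩) (F η₂ ⟨t, ht⟩) = Real.exp (-(Λ * t)) *
        |truncOp n a b p h c₀ L (lift η₁) t - truncOp n a b p h c₀ L (lift η₂) t| := by
      simp only [F, ContinuousMap.coe_mk, Real.dist_eq]
      rw [← mul_sub, abs_mul, Real.abs_exp]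
      congr 2
      ring
    rw [h2]
    calc _ ≤ Real.exp (-(Λ * t)) * (dist η₁ η₂ / 2 * Real.exp (Λ * t)) := by gcongr
      _ = dist η₁ η₂ / 2 * (Real.exp (-(Λ * t)) * Real.exp (Λ * t)) := by ring
      _ = _ := by rw [← Real.exp_add]; simp; ring
  refine ⟨lift (ContractingWith.fixedPoint F hF), hlift _, fun r hr => ?_⟩
  have hfix := hF.fixedPoint_isFixedPt
  have h1 : F (ContractingWith.fixedPoint F hF) ⟨r, hr⟩ =
      ContractingWith.fixedPoint F hF ⟨r, hr⟩ := by rw [hfix.eq]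
  rw [hliftval _ r hr, ← h1]
  simp only [F, ContinuousMap.coe_mk]
  rw [← mul_assoc, ← Real.exp_add]
  simp

/-- Lipschitz dependence on the initial value; in particular uniqueness. -/
lemma exists_truncOp_stability (n : ℕ) (D : Data a b p h)
    (hlip : ∀ W, ∃ K, 0 ≤ K ∧ ∀ x ∈ Icc 0 W, ∀ y ∈ Icc 0 W, |h x - h y| ≤ K * |x - y|)
    (hR : 0 < R) (hc₀ : 0 < c₀) (hL : c₀ ≤ L) :
    ∃ K, 0 ≤ K ∧ ∀ (y₁ y₂ : ℝ → ℝ) (c₁ c₂ : ℝ), Continuous y₁ → Continuous y₂ → ∀ ρ ≤ R,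
      (∀ r ∈ Icc 0 ρ, y₁ r = c₁ + truncOp n a b p h c₀ L y₁ r) →
      (∀ r ∈ Icc 0 ρ, y₂ r = c₂ + truncOp n a b p h c₀ L y₂ r) →
      ∀ r ∈ Icc 0 ρ, |y₁ r - y₂ r| ≤ K * |c₁ - c₂| := by
  obtain ⟨Λ, hΛ0, hΛ⟩ := exists_truncOp_contraction n D hlip hR hc₀ hL
  -- At a maximum point of the weighted difference δ, the contraction gives δ/2 ≤ |c₁ - c₂|;
  -- unweighting costs e^(Λ R).
  refine ⟨2 * Real.exp (Λ * R), by positivity, fun y₁ y₂ c₁ c₂ hy₁ hy₂ ρ hρ he₁ he₂ r hr => ?_⟩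
  have hcont : ContinuousOn (fun s => |y₁ s - y₂ s| * Real.exp (-(Λ * s))) (Icc 0 ρ) := by
    fun_prop
  obtain ⟨s₀, hs₀, hmax⟩ := isCompact_Icc.exists_isMaxOn ⟨r, hr⟩ hcont
  set δ := |y₁ s₀ - y₂ s₀| * Real.exp (-(Λ * s₀)) with hδ
  have hδ0 : 0 ≤ δ := by positivity
  have hbound : ∀ s ∈ Icc 0 ρ, |y₁ s - y₂ s| ≤ δ * Real.exp (Λ * s) := fun s hs => by
    have h1 : |y₁ s - y₂ s| * Real.exp (-(Λ * s)) ≤ δ := hmax hs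
    calc |y₁ s - y₂ s| = |y₁ s - y₂ s| * Real.exp (-(Λ * s)) * Real.exp (Λ * s) := by
          rw [mul_assoc, ← Real.exp_add]; simp
      _ ≤ _ := by gcongr
  have h1 := hΛ y₁ y₂ hy₁ hy₂ ρ hρ δ hδ0 hbound s₀ hs₀
  have h2 : |y₁ s₀ - y₂ s₀| = δ * Real.exp (Λ * s₀) := by
    rw [hδ, mul_assoc, ← Real.exp_add]; simp
  have h3 : |y₁ s₀ - y₂ s₀| ≤ |c₁ - c₂| +
      |truncOp n a b p h c₀ L y₁ s₀ - truncOp n a b p h c₀ L y₂ s₀| := by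
    rw [he₁ s₀ hs₀, he₂ s₀ hs₀, add_sub_add_comm]
    exact abs_add_le _ _
  have h4 : 1 ≤ Real.exp (Λ * s₀) := Real.one_le_exp (mul_nonneg hΛ0.le hs₀.1)
  have h5 : δ / 2 ≤ |c₁ - c₂| := by
    have h6 : δ / 2 * Real.exp (Λ * s₀) ≤ |c₁ - c₂| := by linarith
    exact le_trans (le_mul_of_one_le_right (by positivity) h4) h6
  have h6 : Real.exp (Λ * r) ≤ Real.exp (Λ * R) :=
    Real.exp_le_exp.2 (mul_le_mul_of_nonneg_left (hr.2.trans hρ) hΛ0.le)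
  calc |y₁ r - y₂ r| ≤ δ * Real.exp (Λ * r) := hbound r hr
    _ ≤ (2 * |c₁ - c₂|) * Real.exp (Λ * R) := by gcongr; linarith
    _ = _ := by ring

/-- `y` solves the radial integral equation on `[0, ρ]` with `y(0) = c`. -/
def SolvesOn (n : ℕ) (a b p : ℝ) (h : ℝ → ℝ) (c ρ : ℝ) (y : ℝ → ℝ) : Prop :=
  ∀ r ∈ Icc 0 ρ, y r = c + newt n (source n a b p h y) r

/-- A family `Y L c` of functions, one for each truncation level `L` and initial value `c`, which
captures all solutions with values in `[c₀, L]` and depends continuously on `c`. -/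
structure TruncFamily (n : ℕ) (R a b p : ℝ) (h : ℝ → ℝ) (c₀ : ℝ) (Y : ℝ → ℝ → ℝ → ℝ) :
    Prop where
  cont : ∀ L, c₀ ≤ L → ∀ c, Continuous (Y L c)
  cont_init : ∀ L, c₀ ≤ L → ∀ r ∈ Icc 0 R, Continuous fun c => Y L c r
  zero : ∀ L, c₀ ≤ L → ∀ c, Y L c 0 = c
  mono : ∀ L, c₀ ≤ L → ∀ c, MonotoneOn (Y L c) (Icc 0 R)
  solves : ∀ L, c₀ ≤ L → ∀ c, c₀ ≤ c → ∀ ρ ∈ Icc 0 R, Y L c ρ ≤ L →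
    SolvesOn n a b p h c ρ (Y L c)
  unique : ∀ L, c₀ ≤ L → ∀ c, ∀ ρ ∈ Icc 0 R, ∀ y, ContinuousOn y (Icc 0 ρ) →
    SolvesOn n a b p h c ρ y → (∀ r ∈ Icc 0 ρ, y r ∈ Icc c₀ L) → EqOn y (Y L c) (Icc 0 ρ)

lemma exists_truncFamily (n : ℕ) (D : Data a b p h)
    (hlip : ∀ W, ∃ K, 0 ≤ K ∧ ∀ x ∈ Icc 0 W, ∀ y ∈ Icc 0 W, |h x - h y| ≤ K * |x - y|)
    (hR : 0 < R) (hc₀ : 0 < c₀) : ∃ Y, TruncFamily n R a b p h c₀ Y := by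
  choose! Y hYc hY using fun L (hL : c₀ ≤ L) c => exists_truncOp_fixed n D hlip hR hc₀ hL c
  have hmono : ∀ L, c₀ ≤ L → ∀ c, MonotoneOn (Y L c) (Icc 0 R) := fun L hL c s hs t ht hst => by
    rw [hY L hL c s hs, hY L hL c t ht]
    exact add_le_add_right (monotoneOn_newt_source D (continuous_trunc (hYc L hL c)) hs.1 ht.1
      hst) c
  have hzero : ∀ L, c₀ ≤ L → ∀ c, Y L c 0 = c := fun L hL c => by
    rw [hY L hL c 0 ⟨le_rfl, hR.le⟩, truncOp, newt_zero, add_zero]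
  refine ⟨Y, hYc, fun L hL r hr => ?_, hzero, hmono, fun L hL c hc ρ hρ hle r hr => ?_,
    fun L hL c ρ hρ y hy hsol hran r hr => ?_⟩
  · obtain ⟨K, -, hK⟩ := exists_truncOp_stability n D hlip hR hc₀ hL
    exact (LipschitzWith.of_dist_le' (K := K) fun c₁ c₂ =>
      hK _ _ c₁ c₂ (hYc L hL _) (hYc L hL _) R le_rfl (hY L hL c₁) (hY L hL c₂) r hr).continuous
  · have hrR : r ∈ Icc 0 R := ⟨hr.1, hr.2.trans hρ.2⟩
    refine (hY L hL c r hrR).trans (congrArg _ (newt_source_congr hr.1 fun t ht => ?_))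
    have htR : t ∈ Icc 0 R := ⟨ht.1, ht.2.trans hrR.2⟩
    refine trunc_eq ?_ ((hmono L hL c htR hρ (ht.2.trans hr.2)).trans hle)
    have := hmono L hL c ⟨le_rfl, hR.le⟩ htR ht.1
    rw [hzero L hL c] at this
    exact hc.trans this
  · obtain ⟨K, -, hK⟩ := exists_truncOp_stability n D hlip hR hc₀ hL
    -- Stability concerns functions continuous on the whole line; freezing y beyond ρ changes
    -- nothing on [0, ρ].
    have heq : EqOn (clampTo ρ y) y (Icc 0 ρ) := fun t ht => clampTo_eq y ht.1 ht.2
    have h1 := hK (clampTo ρ y) (Y L c) c c (continuous_clampTo hρ.1 hy) (hYc L hL c) ρ hρ.2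
      (fun s hs => by
        rw [heq hs, hsol s hs]
        refine congrArg _ (newt_source_congr hs.1 fun t ht => ?_)
        have htρ : t ∈ Icc 0 ρ := ⟨ht.1, ht.2.trans hs.2⟩
        simp only [heq htρ]
        exact (trunc_eq (hran t htρ).1 (hran t htρ).2).symm)
      (fun s hs => hY L hL c s ⟨hs.1, hs.2.trans hρ.2⟩) r hr
    rw [sub_self, abs_zero, mul_zero, heq hr] at h1
    linarith [abs_nonpos_iff.1 h1]

end Family

/-! ### Shooting for an unbounded solution -/

section Existence

variable {n : ℕ} {a b p R c₀ : ℝ} {h : ℝ → ℝ}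

lemma IsProfile.solvesOn {v : ℝ → ℝ} (hv : IsProfile n R a b p h v) {ρ : ℝ} (hρ : ρ < R) :
    SolvesOn n a b p h (v 0) ρ v := fun r hr => hv.eq r ⟨hr.1, hr.2.trans_lt hρ⟩

lemma SolvesOn.isProfile {c : ℝ} {v : ℝ → ℝ} (hR : 0 < R) (hc : ContinuousOn v (Ico 0 R))
    (h0 : ∀ r ∈ Ico 0 R, 0 < v r) (hs : ∀ ρ ∈ Ico 0 R, SolvesOn n a b p h c ρ v) :
    IsProfile n R a b p h v := by
  have hv0 : v 0 = c := by
    have := hs 0 ⟨le_rfl, hR⟩ 0 ⟨le_rfl, le_rfl⟩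
    rwa [newt_zero, add_zero] at this
  exact ⟨hc, h0, fun r hr => hv0 ▸ hs r hr r ⟨hr.1, le_rfl⟩⟩

namespace TruncFamily

variable {Y : ℝ → ℝ → ℝ → ℝ} (hY : TruncFamily n R a b p h c₀ Y)
include hY

lemma init_le {L c r : ℝ} (hL : c₀ ≤ L) (hr : r ∈ Icc 0 R) : c ≤ Y L c r := by
  have := hY.mono L hL c ⟨le_rfl, hr.1.trans hr.2⟩ hr hr.1
  rwa [hY.zero L hL] at this

lemma mem_Icc {L c r s : ℝ} (hL : c₀ ≤ L) (hc : c₀ ≤ c) (hr : r ∈ Icc 0 R) (hle : Y L c r ≤ L)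
    (hs : s ∈ Icc 0 r) : Y L c s ∈ Icc c₀ L := by
  have hsR : s ∈ Icc 0 R := ⟨hs.1, hs.2.trans hr.2⟩
  exact ⟨hc.trans (hY.init_le hL hsR), (hY.mono L hL c hsR hr hs.2).trans hle⟩

/-- Below its truncation level, a member of the family does not depend on the level. -/
lemma eqOn_of_le {L L' c r : ℝ} (hL : c₀ ≤ L) (hL' : L ≤ L') (hc : c₀ ≤ c) (hr : r ∈ Icc 0 R)
    (hle : Y L c r ≤ L) : EqOn (Y L c) (Y L' c) (Icc 0 r) :=
  hY.unique L' (hL.trans hL') c r hr _ (hY.cont L hL c).continuousOn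
    (hY.solves L hL c hc r hr hle) fun _ hs =>
      Icc_subset_Icc_right hL' (hY.mem_Icc hL hc hr hle hs)

lemma eq_of_le {L L' c r : ℝ} (hL : c₀ ≤ L) (hL' : c₀ ≤ L') (hc : c₀ ≤ c) (hr : r ∈ Icc 0 R)
    (hle : Y L c r ≤ L) (hle' : Y L' c r ≤ L') : Y L c r = Y L' c r := by
  rcases le_total L L' with hLL | hLL
  · exact hY.eqOn_of_le hL hLL hc hr hle ⟨hr.1, le_rfl⟩
  · exact (hY.eqOn_of_le hL' hLL hc hr hle' ⟨hr.1, le_rfl⟩).symm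

lemma isProfile {L c : ℝ} (hR : 0 < R) (hc₀ : 0 < c₀) (hL : c₀ ≤ L) (hc : c₀ ≤ c)
    (hle : Y L c R ≤ L) : IsProfile n R a b p h (Y L c) :=
  SolvesOn.isProfile hR (hY.cont L hL c).continuousOn
    (fun _ hr => hc₀.trans_le (hc.trans (hY.init_le hL ⟨hr.1, hr.2.le⟩)))
    fun _ hρ r hr => hY.solves L hL c hc R ⟨hR.le, le_rfl⟩ hle r ⟨hr.1, hr.2.trans hρ.2.le⟩

/-- Shooting: if the solution starting at `c₀` stays below `L`, then some larger initial value
gives a solution with value `L` at `r = R`. -/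
lemma exists_init (hR : 0 < R) {L : ℝ} (hL : c₀ ≤ L)
    (hle : Y L c₀ R ≤ L) : ∃ c, c₀ ≤ c ∧ Y L c R = L := by
  have hRR : R ∈ Icc 0 R := ⟨hR.le, le_rfl⟩
  -- The value at R is at most L for c = c₀, and at least L for c = L since solutions are
  -- nondecreasing.
  obtain ⟨c, hc, he⟩ := intermediate_value_Icc hL (hY.cont_init L hL R hRR).continuousOn
    ⟨hle, hY.init_le hL hRR⟩
  exact ⟨c, hc.1, he⟩

end TruncFamily

lemma le_at_right_endpoint {f : ℝ → ℝ} {R M : ℝ} (hR : 0 < R) (hf : Continuous f)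
    (h : ∀ r ∈ Ico 0 R, f r ≤ M) : f R ≤ M := by
  refine le_of_tendsto (hf.continuousWithinAt (s := Iio R) (x := R)) ?_
  filter_upwards [Ioo_mem_nhdsLT hR] with r hr
  exact h r ⟨hr.1.le, hr.2⟩

/-- If `I₀ < ∞` and some solution exists on `[0, R)`, then some solution on `[0, R)` is
unbounded. -/
theorem exists_unbounded_profile (D : Data a b p h)
    (hlip : ∀ W, ∃ K, 0 ≤ K ∧ ∀ x ∈ Icc 0 W, ∀ y ∈ Icc 0 W, |h x - h y| ≤ K * |x - y|)
    (hR : 0 < R) (hI : I₀ p h < ⊤) {v₀ : ℝ → ℝ} (hv₀ : IsProfile n R a b p h v₀) :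
    ∃ v, IsProfile n R a b p h v ∧ ∀ M, ∃ r ∈ Ico 0 R, M < v r := by
  by_cases hunb : ∀ M, ∃ r ∈ Ico 0 R, M < v₀ r
  · exact ⟨v₀, hv₀, hunb⟩
  push Not at hunb
  obtain ⟨M₀, hM₀⟩ := hunb
  have h0R : (0 : ℝ) ∈ Ico 0 R := ⟨le_rfl, hR⟩
  have hRR : R ∈ Icc 0 R := ⟨hR.le, le_rfl⟩
  set c₀ := v₀ 0
  have hc₀ : 0 < c₀ := hv₀.pos 0 h0R
  have hcM : c₀ ≤ M₀ := hM₀ 0 h0R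
  obtain ⟨Y, hY⟩ := exists_truncFamily n D hlip hR hc₀
  have hlow : ∀ L, M₀ ≤ L → Y L c₀ R ≤ L := by
    intro L hL
    refine (le_at_right_endpoint hR (hY.cont L (hcM.trans hL) c₀) fun r hr => ?_).trans hL
    have h1 := hY.unique L (hcM.trans hL) c₀ r ⟨hr.1, hr.2.le⟩ v₀
      (hv₀.cont.mono (Icc_subset_Ico_of_lt le_rfl hr.2)) (hv₀.solvesOn hr.2)
      (fun s hs => ⟨hv₀.monotoneOn D h0R ⟨hs.1, hs.2.trans_lt hr.2⟩ hs.1,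
        (hM₀ s ⟨hs.1, hs.2.trans_lt hr.2⟩).trans hL⟩) ⟨hr.1, le_rfl⟩
    rw [← h1]
    exact hM₀ r hr
  -- solutions with prescribed finite values at `R`
  have hlev : ∀ k : ℕ, M₀ ≤ M₀ + k := fun k => by simp
  have hlev' : ∀ k : ℕ, c₀ ≤ M₀ + k := fun k => hcM.trans (hlev k)
  choose c hcc hcR using fun k : ℕ => hY.exists_init hR (hlev' k)
    (hlow _ (hlev k))
  have hprof : ∀ k : ℕ, IsProfile n R a b p h (Y (M₀ + k) (c k)) := fun k =>
    hY.isProfile hR hc₀ (hlev' k) (hcc k) (hcR k).le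
  -- The uniform interior bound is taken up to the midpoint of r and R, which leaves room to the
  -- right of r for gluing and continuity.
  have hbd : ∀ r ∈ Ico 0 R, ∃ K, c₀ ≤ K ∧ ∀ v, IsProfile n R a b p h v →
      ∀ s ∈ Icc 0 ((r + R) / 2), v s ≤ K := by
    intro r hr
    obtain ⟨K, hK⟩ := exists_profile_le (R := R) (r := (r + R) / 2) n D hI
      ⟨by linarith [hr.1], by linarith [hr.2]⟩
    exact ⟨max K c₀, le_max_right _ _, fun v hv s hs => (hK v hv s hs).trans (le_max_left _ _)⟩
  choose! κ hκ₀ hκ using hbd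
  have hmid : ∀ r ∈ Ico 0 R, r < (r + R) / 2 ∧ (r + R) / 2 < R ∧ (0 : ℝ) ≤ (r + R) / 2 :=
    fun r hr => ⟨by linarith [hr.2], by linarith [hr.2], by linarith [hr.1]⟩
  -- the initial values accumulate
  have hcK : ∀ k, c k ∈ Icc c₀ (κ 0) := fun k => ⟨hcc k, by
    have := hκ 0 h0R _ (hprof k) 0 ⟨le_rfl, (hmid 0 h0R).2.2⟩
    rwa [hY.zero _ (hlev' k)] at this⟩
  obtain ⟨cs, hcs, φ, hφ, hlim⟩ := isCompact_Icc.tendsto_subseq hcK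
  have hYlim : ∀ L, c₀ ≤ L → ∀ r ∈ Icc 0 R,
      Tendsto (fun k => Y L (c (φ k)) r) atTop (𝓝 (Y L cs r)) := fun L hL r hr =>
    ((hY.cont_init L hL r hr).tendsto cs).comp hlim
  have hYκ : ∀ r ∈ Ico 0 R, Y (κ r) cs ((r + R) / 2) ≤ κ r := by
    intro r hr
    obtain ⟨h1, h2, h3⟩ := hmid r hr
    refine le_of_tendsto (hYlim _ (hκ₀ r hr) _ ⟨h3, h2.le⟩) (Eventually.of_forall fun k => ?_)
    have hk := hprof (φ k)
    have hz := hY.zero _ (hlev' (φ k)) (c (φ k))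
    have hsol := hk.solvesOn h2
    rw [hz] at hsol
    have h4 := hY.unique (κ r) (hκ₀ r hr) (c (φ k)) _ ⟨h3, h2.le⟩ _
      (hk.cont.mono (Icc_subset_Ico_of_lt le_rfl h2)) hsol
      (fun s hs => ⟨(hcc _).trans (hY.init_le (hlev' _) ⟨hs.1, hs.2.trans h2.le⟩),
        hκ r hr _ hk s hs⟩) ⟨h3, le_rfl⟩
    rw [← h4]
    exact hκ r hr _ hk _ ⟨h3, le_rfl⟩
  -- At level κ r the truncation is inactive up to the midpoint, so the limit member solves the
  -- original equation there.
  have hYκ' : ∀ r ∈ Ico 0 R, ∀ s ∈ Icc 0 ((r + R) / 2), Y (κ r) cs s ≤ κ r := fun r hr s hs =>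
    (hY.mem_Icc (hκ₀ r hr) hcs.1 ⟨(hmid r hr).2.2, (hmid r hr).2.1.le⟩ (hYκ r hr) hs).2
  -- the limit solution
  set v : ℝ → ℝ := fun r => Y (κ r) cs r with hvdef
  have hloc : ∀ r ∈ Ico 0 R, EqOn v (Y (κ r) cs) (Icc 0 ((r + R) / 2)) := by
    intro r hr s hs
    have hsR : s ∈ Ico 0 R := ⟨hs.1, hs.2.trans_lt (hmid r hr).2.1⟩
    exact hY.eq_of_le (hκ₀ s hsR) (hκ₀ r hr) hcs.1 ⟨hs.1, hsR.2.le⟩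
      (hYκ' s hsR s ⟨hs.1, (hmid s hsR).1.le⟩) (hYκ' r hr s hs)
  have hvsol : ∀ ρ ∈ Ico 0 R, SolvesOn n a b p h cs ρ v := by
    intro ρ hρ r hr
    have hsub : Icc 0 ρ ⊆ Icc 0 ((ρ + R) / 2) := Icc_subset_Icc_right (hmid ρ hρ).1.le
    rw [hloc ρ hρ (hsub hr), newt_source_congr hr.1
      (((hloc ρ hρ).mono hsub).mono (Icc_subset_Icc_right hr.2))]
    exact hY.solves _ (hκ₀ ρ hρ) cs hcs.1 ρ ⟨hρ.1, hρ.2.le⟩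
      (hYκ' ρ hρ ρ ⟨hρ.1, (hmid ρ hρ).1.le⟩) r hr
  have hvlow : ∀ r ∈ Ico 0 R, c₀ ≤ v r := fun r hr =>
    hcs.1.trans (hY.init_le (hκ₀ r hr) ⟨hr.1, hr.2.le⟩)
  have hvcont : ContinuousOn v (Ico 0 R) := by
    intro r hr
    refine (hY.cont _ (hκ₀ r hr) cs).continuousWithinAt.congr_of_eventuallyEq ?_ rfl
    filter_upwards [self_mem_nhdsWithin, nhdsWithin_le_nhds (gt_mem_nhds (hmid r hr).1)]
      with s hs hs'
    exact hloc r hr ⟨hs.1, le_of_lt hs'⟩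
  refine ⟨v, SolvesOn.isProfile hR hvcont (fun r hr => hc₀.trans_le (hvlow r hr)) hvsol, ?_⟩
  by_contra! hbdd
  obtain ⟨M, hM⟩ := hbdd
  -- Truncating one unit above the supposed bound leaves a gap at R that survives small changes of
  -- the initial value.
  have hL : c₀ ≤ M + 1 := by linarith [hvlow 0 h0R, hM 0 h0R]
  have h1 : Y (M + 1) cs R ≤ M := by
    refine le_at_right_endpoint hR (hY.cont _ hL cs) fun r hr => ?_
    have h2 := hY.unique (M + 1) hL cs r ⟨hr.1, hr.2.le⟩ v
      (hvcont.mono (Icc_subset_Ico_of_lt le_rfl hr.2)) (hvsol r hr)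
      (fun s hs => ⟨hvlow s ⟨hs.1, hs.2.trans_lt hr.2⟩, by
        linarith [hM s ⟨hs.1, hs.2.trans_lt hr.2⟩]⟩) ⟨hr.1, le_rfl⟩
    rw [← h2]
    exact hM r hr
  have h2 : ∀ᶠ k in atTop, Y (M + 1) (c (φ k)) R < M + 1 :=
    (hYlim _ hL R hRR).eventually_lt_const (by linarith)
  have h3 : ∀ᶠ k in atTop, M + 1 - M₀ ≤ (φ k : ℝ) :=
    (tendsto_natCast_atTop_atTop.comp hφ.tendsto_atTop).eventually_ge_atTop _
  obtain ⟨k, hk1, hk2⟩ := (h2.and h3).exists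
  -- For such k the solution stays below M + 1 up to R, so it is the same at the higher level M₀ + φ
  -- k, where its value at R was prescribed to be M₀ + φ k ≥ M + 1: a contradiction.
  have h4 := hY.eqOn_of_le hL (L' := M₀ + φ k) (by linarith) (hcc (φ k)) hRR hk1.le
    ⟨hR.le, le_rfl⟩
  rw [hcR (φ k)] at h4
  linarith

end Existence

/-! ### Extending `h` to the whole line -/

section Extension

variable {a b p : ℝ} {h : ℝ → ℝ}

/-- Extension of `h` from `[0, ∞)` to the line by the constant `h 0`. -/
def extend (h : ℝ → ℝ) (t : ℝ) : ℝ := h (max 0 t)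

lemma extend_eq {t : ℝ} (ht : 0 ≤ t) : extend h t = h t := by simp [extend, ht]

lemma data_extend (ha : 0 ≤ a) (hb : 0 ≤ b) (hp : 0 < p) (hc : ContinuousOn h (Ici 0))
    (hmono : MonotoneOn h (Ici 0)) (hpos : ∀ t : ℝ, 0 < t → 0 < h t) :
    Data a b p (extend h) where
  ha := ha
  hb := hb
  hp := hp
  cont := hc.comp_continuous (by fun_prop) fun t => le_max_left 0 t
  mono := fun s t hst => hmono (le_max_left 0 s) (le_max_left 0 t) (max_le_max le_rfl hst)
  pos := fun t ht => by rw [extend_eq ht.le]; exact hpos t ht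
  nonneg := fun t => by
    have h0 : 0 ≤ h 0 := by
      refine ge_of_tendsto ((hc 0 self_mem_Ici).mono Ioi_subset_Ici_self) ?_
      filter_upwards [self_mem_nhdsWithin] with s hs
      exact (hpos s hs).le
    exact h0.trans (hmono self_mem_Ici (le_max_left 0 t) (le_max_left 0 t))

lemma lipschitz_extend (hC1 : ContDiffOn ℝ 1 h (Ici 0)) (W : ℝ) :
    ∃ K, 0 ≤ K ∧ ∀ x ∈ Icc 0 W, ∀ y ∈ Icc 0 W, |extend h x - extend h y| ≤ K * |x - y| := by
  obtain ⟨K, hK0, hK⟩ := exists_lipschitz_of_hasDerivWithinAt (f := h)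
    (f' := derivWithin h (Ici 0)) (α := 0) (β := W)
    (fun x hx => ((hC1.differentiableOn (by norm_num)) x hx.1).hasDerivWithinAt.mono
      Icc_subset_Ici_self)
    ((hC1.continuousOn_derivWithin (uniqueDiffOn_Ici 0) le_rfl).mono Icc_subset_Ici_self)
  refine ⟨K, hK0, fun x hx y hy => ?_⟩
  rw [extend_eq hx.1, extend_eq hy.1]
  exact hK x hx y hy

lemma H_extend {t : ℝ} (ht : 0 ≤ t) : H (extend h) t = H h t := by
  refine intervalIntegral.integral_congr fun s hs => ?_
  rw [uIcc_of_le ht] at hs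
  exact extend_eq hs.1

lemma denom_extend {s : ℝ} (hs : 0 ≤ s) : denom p (extend h) s = denom p h s := by
  rw [denom, denom]
  congr 1
  refine intervalIntegral.integral_congr fun t ht => ?_
  rw [uIcc_of_le hs] at ht
  exact H_extend ht.1

lemma I₀_extend : I₀ p (extend h) = I₀ p h := by
  refine setLIntegral_congr_fun measurableSet_Ioi fun s hs => ?_
  have hs0 : (0 : ℝ) ≤ s := zero_le_one.trans (le_of_lt hs)
  simp only [denom_extend hs0]

lemma I₁_extend : I₁ p (extend h) = I₁ p h := by
  refine setLIntegral_congr_fun measurableSet_Ioi fun s hs => ?_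
  have hs0 : (0 : ℝ) ≤ s := zero_le_one.trans (le_of_lt hs)
  simp only [denom_extend hs0]

end Extension

/-! ### Boundedness and blow-up in terms of the radial variable -/

section Boundary

variable {n : ℕ} {R : ℝ} {w : EuclideanSpace ℝ (Fin (n + 1)) → ℝ} {g : ℝ → ℝ}

lemma exists_norm_eq (n : ℕ) {r : ℝ} (hr : 0 ≤ r) :
    ∃ x : EuclideanSpace ℝ (Fin (n + 1)), ‖x‖ = r :=
  ⟨r • EuclideanSpace.basisFun (Fin (n + 1)) ℝ 0, by
    rw [norm_smul, (EuclideanSpace.basisFun (Fin (n + 1)) ℝ).orthonormal.1 0, mul_one,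
      Real.norm_of_nonneg hr]⟩

lemma mem_B {x : EuclideanSpace ℝ (Fin (n + 1))} : x ∈ B (n + 1) R ↔ ‖x‖ < R := by simp

lemma boundedIn_iff (hw : ∀ x ∈ B (n + 1) R, w x = g ‖x‖) (hpos : ∀ x ∈ B (n + 1) R, 0 < w x) :
    BoundedIn (n + 1) R w ↔ ∃ M, ∀ r ∈ Ico 0 R, g r ≤ M := by
  constructor
  · rintro ⟨M, hM⟩
    refine ⟨M, fun r hr => ?_⟩
    obtain ⟨x, rfl⟩ := exists_norm_eq n hr.1
    rw [← hw x (mem_B.2 hr.2)]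
    exact (le_abs_self _).trans (hM x (mem_B.2 hr.2))
  · rintro ⟨M, hM⟩
    refine ⟨M, fun x hx => ?_⟩
    rw [abs_of_pos (hpos x hx), hw x hx]
    exact hM _ ⟨norm_nonneg x, mem_B.1 hx⟩

lemma blowsUp_iff (hR : 0 < R) (hw : ∀ x ∈ B (n + 1) R, w x = g ‖x‖)
    (hg : MonotoneOn g (Ico 0 R)) :
    BlowsUp (n + 1) R w ↔ ∀ M, ∃ r ∈ Ico 0 R, M < g r := by
  constructor
  · intro h M
    obtain ⟨t, ht, hts⟩ := mem_comap.1 (h.eventually_gt_atTop M)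
    obtain ⟨r, hrt, hr⟩ := (Filter.nonempty_of_mem (inter_mem ht (Ioo_mem_nhdsLT hR)))
    obtain ⟨x, rfl⟩ := exists_norm_eq n hr.1.le
    refine ⟨‖x‖, ⟨hr.1.le, hr.2⟩, ?_⟩
    rw [← hw x (mem_B.2 hr.2)]
    exact hts hrt
  · intro h
    refine tendsto_atTop.2 fun M => ?_
    obtain ⟨r, hr, hM⟩ := h M
    filter_upwards [preimage_mem_comap (Ioo_mem_nhdsLT hr.2)] with x hx
    rw [hw x (mem_B.2 hx.2)]
    exact hM.le.trans (hg hr ⟨norm_nonneg x, hx.2⟩ hx.1.le)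

lemma not_boundedIn_iff_blowsUp (hR : 0 < R) (hw : ∀ x ∈ B (n + 1) R, w x = g ‖x‖)
    (hpos : ∀ x ∈ B (n + 1) R, 0 < w x) (hg : MonotoneOn g (Ico 0 R)) :
    ¬ BoundedIn (n + 1) R w ↔ BlowsUp (n + 1) R w := by
  rw [boundedIn_iff hw hpos, blowsUp_iff hR hw hg]
  push Not
  rfl

end Boundary

/-! ### Correspondence between solutions and profiles -/

section Correspondence

variable {n : ℕ} {R a b p : ℝ} {h : ℝ → ℝ}

lemma gradient_const_add {E : Type*} [NormedAddCommGroup E] [InnerProductSpace ℝ E]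
    [CompleteSpace E] (c : ℝ) (f : E → ℝ) (x : E) :
    gradient (fun y => c + f y) x = gradient f x := by
  rw [gradient, gradient, fderiv_const_add]

lemma laplacian_const_add (c : ℝ) {f : EuclideanSpace ℝ (Fin (n + 1)) → ℝ}
    {x : EuclideanSpace ℝ (Fin (n + 1))} (hf : ContDiffAt ℝ 2 f x) :
    Laplacian.laplacian (fun y => c + f y) x = Laplacian.laplacian f x := by
  have := (contDiffAt_const (c := c)).laplacian_add hf
  simpa [Pi.add_def] using this

/-- Every positive radial solution is given by a profile. -/
theorem IsPositiveRadialSolution.exists_profile (hR : 0 < R) (D : Data a b p (extend h))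
    {u v : EuclideanSpace ℝ (Fin (n + 1)) → ℝ}
    (hs : IsPositiveRadialSolution (n + 1) R a b p h u v) :
    ∃ V, IsProfile n R a b p (extend h) V ∧ (∀ x ∈ B (n + 1) R, v x = V ‖x‖) ∧
      ∀ x ∈ B (n + 1) R, u x = u 0 + newt n (fun t => t ^ a * V t ^ p) ‖x‖ := by
  set e := EuclideanSpace.basisFun (Fin (n + 1)) ℝ 0
  have he : ‖e‖ = 1 := (EuclideanSpace.basisFun (Fin (n + 1)) ℝ).orthonormal.1 0
  have hen : ∀ r ∈ Ico 0 R, ‖r • e‖ = r := fun r hr => by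
    rw [norm_smul, he, mul_one, Real.norm_of_nonneg hr.1]
  have hmem : ∀ r ∈ Ico 0 R, r • e ∈ B (n + 1) R := fun r hr =>
    mem_B.2 (by rw [hen r hr]; exact hr.2)
  have hnorm : ∀ x ∈ B (n + 1) R, ‖x‖ ∈ Ico 0 R := fun x hx => ⟨norm_nonneg x, mem_B.1 hx⟩
  set V : ℝ → ℝ := fun r => v (r • e) with hV
  have hvV : ∀ x ∈ B (n + 1) R, v x = V ‖x‖ := fun x hx =>
    hs.radial_v x hx _ (hmem _ (hnorm x hx)) (hen _ (hnorm x hx)).symm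
  have hVc : ContinuousOn V (Ico 0 R) :=
    hs.contDiffOn_v.continuousOn.comp (by fun_prop) hmem
  have hV0 : ∀ r ∈ Ico 0 R, 0 < V r := fun r hr => hs.pos_v _ (hmem r hr)
  have hwc := continuousOn_weight (p := p) D.ha D.hp hVc
  have hu : ∀ x ∈ B (n + 1) R, u x = u 0 + newt n (fun t => t ^ a * V t ^ p) ‖x‖ :=
    fun x hx => eq_newt_of_laplacian_eq hR hs.contDiffOn_u hs.radial_u hwc
      (fun y hy => by rw [hs.eq_u y hy, hvV y hy]) hx
  -- The average of the positive weight is nonnegative, so |∇u| is the slope itself and h is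
  -- evaluated only where it agrees with its extension.
  have hgrad : ∀ x ∈ B (n + 1) R, ‖gradient u x‖ = slope n a p V ‖x‖ := by
    intro x hx
    have h1 : u =ᶠ[𝓝 x] fun y => u 0 + newt n (fun t => t ^ a * V t ^ p) ‖y‖ := by
      filter_upwards [Metric.isOpen_ball.mem_nhds hx] with y hy using hu y hy
    have h2 : 0 ≤ avg n (fun t => t ^ a * V t ^ p) ‖x‖ :=
      avg_nonneg n (norm_nonneg x) fun t ht =>
        weight_nonneg hV0 t ⟨ht.1, ht.2.trans_lt (mem_B.1 hx)⟩
    rw [h1.gradient_eq, gradient_const_add, gradient_newt_norm_of_continuousOn n hwc hx,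
      norm_smul, Real.norm_of_nonneg h2, mul_comm, slope]
  have hv : ∀ x ∈ B (n + 1) R, v x = v 0 + newt n (source n a b p (extend h) V) ‖x‖ :=
    fun x hx => eq_newt_of_laplacian_eq hR hs.contDiffOn_v hs.radial_v
      (continuousOn_source D hVc) (fun y hy => by
        rw [hs.eq_v y hy, hgrad y hy, source, extend_eq (slope_nonneg hV0 (hnorm y hy))]) hx
  refine ⟨V, ⟨hVc, hV0, fun r hr => ?_⟩, hvV, hu⟩
  have h1 := hv _ (hmem r hr)
  rw [hen r hr] at h1
  simpa [hV] using h1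

/-- Every profile gives a positive radial solution. -/
theorem IsProfile.isPositiveRadialSolution (D : Data a b p (extend h)) {V : ℝ → ℝ}
    (hV : IsProfile n R a b p (extend h) V) :
    IsPositiveRadialSolution (n + 1) R a b p h
      (fun x => 1 + newt n (fun t => t ^ a * V t ^ p) ‖x‖) (fun x => V ‖x‖) := by
  have hnorm : ∀ x ∈ B (n + 1) R, ‖x‖ ∈ Ico 0 R := fun x hx => ⟨norm_nonneg x, mem_B.1 hx⟩
  have hwc := continuousOn_weight D.ha D.hp hV.cont
  have hsc := continuousOn_source (n := n) D hV.cont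
  have hvc : ∀ x ∈ B (n + 1) R, V ‖x‖ = V 0 + newt n (source n a b p (extend h) V) ‖x‖ :=
    fun x hx => hV.eq _ (hnorm x hx)
  have havg : ∀ x ∈ B (n + 1) R, 0 ≤ avg n (fun t => t ^ a * V t ^ p) ‖x‖ := fun x hx =>
    avg_nonneg n (norm_nonneg x) fun t ht =>
      weight_nonneg hV.pos t ⟨ht.1, ht.2.trans_lt (mem_B.1 hx)⟩
  have hnhds : ∀ x ∈ B (n + 1) R, B (n + 1) R ∈ 𝓝 x := fun x hx => Metric.isOpen_ball.mem_nhds hx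
  refine ⟨contDiffOn_const.add (contDiffOn_newt_norm n hwc),
    (contDiffOn_const.add (contDiffOn_newt_norm n hsc)).congr hvc, fun x hx => ?_,
    fun x hx => hV.pos _ (hnorm x hx), fun x _ y _ hxy => by rw [hxy],
    fun x _ y _ hxy => by rw [hxy], fun x hx => ?_, fun x hx => ?_⟩
  -- The potential is nonnegative, so the additive constant 1 makes u positive; it affects neither
  -- equation, since u enters only through derivatives.
  · have h1 := hV.monotoneOn_newt_weight D ⟨le_rfl, (norm_nonneg x).trans_lt (mem_B.1 hx)⟩
      (hnorm x hx) (norm_nonneg x)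
    rw [newt_zero] at h1
    linarith
  · rw [laplacian_const_add 1 ((contDiffOn_newt_norm n hwc).contDiffAt (hnhds x hx)),
      laplacian_newt_norm_of_continuousOn n hwc hx]
  · have h1 : (fun y : EuclideanSpace ℝ (Fin (n + 1)) => V ‖y‖) =ᶠ[𝓝 x]
        fun y => V 0 + newt n (source n a b p (extend h) V) ‖y‖ := by
      filter_upwards [hnhds x hx] with y hy using hvc y hy
    rw [(InnerProductSpace.laplacian_congr_nhds h1).self_of_nhds,
      laplacian_const_add _ ((contDiffOn_newt_norm n hsc).contDiffAt (hnhds x hx)),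
      laplacian_newt_norm_of_continuousOn n hsc hx, gradient_const_add,
      gradient_newt_norm_of_continuousOn n hwc hx, norm_smul, Real.norm_of_nonneg (havg x hx),
      mul_comm _ ‖x‖, source, extend_eq (slope_nonneg hV.pos (hnorm x hx)), slope]

end Correspondence

/-! ### Boundary behaviour and the main theorem -/

section Dichotomy

variable {n : ℕ} {R a b p : ℝ} {h : ℝ → ℝ} {u v : EuclideanSpace ℝ (Fin (n + 1)) → ℝ}

/-- The boundary behaviour of a single solution. -/
theorem IsPositiveRadialSolution.boundary_behaviour (hR : 0 < R) (D : Data a b p (extend h))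
    (hs : IsPositiveRadialSolution (n + 1) R a b p h u v) :
    (¬ BoundedIn (n + 1) R u ↔ BlowsUp (n + 1) R u) ∧
    (¬ BoundedIn (n + 1) R v ↔ BlowsUp (n + 1) R v) ∧
    (BoundedIn (n + 1) R v → BoundedIn (n + 1) R u) ∧
    (BlowsUp (n + 1) R v → I₀ p h < ⊤) ∧
    (I₁ p h < ⊤ → BoundedIn (n + 1) R u) ∧
    (BoundedIn (n + 1) R u → BlowsUp (n + 1) R v → I₁ p h < ⊤) := by
  obtain ⟨V, hV, hvV, huV⟩ := hs.exists_profile hR D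
  have hum : MonotoneOn (fun r => u 0 + newt n (fun t => t ^ a * V t ^ p) r) (Ico 0 R) :=
    fun s hs t ht hst => add_le_add_right (hV.monotoneOn_newt_weight D hs ht hst) (u 0)
  have hub : BoundedIn (n + 1) R u ↔
      ∃ M, ∀ r ∈ Ico 0 R, newt n (fun t => t ^ a * V t ^ p) r ≤ M := by
    rw [boundedIn_iff (g := fun r => u 0 + newt n (fun t => t ^ a * V t ^ p) r) huV hs.pos_u]
    exact ⟨fun ⟨M, hM⟩ => ⟨M - u 0, fun r hr => by linarith [hM r hr]⟩,
      fun ⟨M, hM⟩ => ⟨u 0 + M, fun r hr => by linarith [hM r hr]⟩⟩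
  have hvb := boundedIn_iff hvV hs.pos_v
  have hvu := blowsUp_iff hR hvV (hV.monotoneOn D)
  refine ⟨not_boundedIn_iff_blowsUp hR huV hs.pos_u hum,
    not_boundedIn_iff_blowsUp hR hvV hs.pos_v (hV.monotoneOn D), ?_, ?_, ?_, ?_⟩
  · rw [hub, hvb]
    rintro ⟨M, hM⟩
    exact hV.bddAbove_newt_weight_of_bdd D hR hM
  · rw [hvu, ← I₀_extend]
    exact hV.I₀_lt_top D hR
  · rw [hub, ← I₁_extend]
    exact hV.bddAbove_newt_weight D hR
  · rw [hub, hvu, ← I₁_extend]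
    rintro ⟨M, hM⟩ hunb
    exact hV.I₁_lt_top D hR hunb hM

theorem IsPositiveRadialSolution.exists_blowsUp (hR : 0 < R) (D : Data a b p (extend h))
    (hC1 : ContDiffOn ℝ 1 h (Ici 0)) (hI : I₀ p h < ⊤)
    (hs : IsPositiveRadialSolution (n + 1) R a b p h u v) :
    ∃ u₁ v₁, IsPositiveRadialSolution (n + 1) R a b p h u₁ v₁ ∧ BlowsUp (n + 1) R v₁ := by
  obtain ⟨V₀, hV₀, -, -⟩ := hs.exists_profile hR D
  obtain ⟨V, hV, hunb⟩ := exists_unbounded_profile D (lipschitz_extend hC1) hR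
    (by rwa [I₀_extend]) hV₀
  exact ⟨_, _, hV.isPositiveRadialSolution D,
    (blowsUp_iff hR (fun _ _ => rfl) (hV.monotoneOn D)).2 hunb⟩

end Dichotomy

end RadialSystem

theorem theorem2p2 (N : ℕ) (hN : 1 ≤ N) (R : ℝ) (hR : 0 < R)
    (a b p : ℝ) (ha : 0 ≤ a) (hb : 0 ≤ b) (hp : 0 < p)
    (h : ℝ → ℝ) (hC1 : ContDiffOn ℝ 1 h (Set.Ici 0))
    (hmono : MonotoneOn h (Set.Ici 0)) (hpos : ∀ t : ℝ, 0 < t → 0 < h t)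
    (u v : EuclideanSpace ℝ (Fin N) → ℝ)
    (huv : RadialSystem.IsPositiveRadialSolution N R a b p h u v) :
    -- (i)
    ((∀ u₁ v₁ : EuclideanSpace ℝ (Fin N) → ℝ,
        RadialSystem.IsPositiveRadialSolution N R a b p h u₁ v₁ →
          RadialSystem.BoundedIn N R u₁ ∧ RadialSystem.BoundedIn N R v₁) ↔
      RadialSystem.I₀ p h = ⊤) ∧
    -- (ii)
    ((∃ u₁ v₁ : EuclideanSpace ℝ (Fin N) → ℝ,
        RadialSystem.IsPositiveRadialSolution N R a b p h u₁ v₁ ∧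
          RadialSystem.BoundedIn N R u₁ ∧ RadialSystem.BlowsUp N R v₁) ↔
      RadialSystem.I₁ p h < ⊤) ∧
    -- (iii)
    ((∃ u₁ v₁ : EuclideanSpace ℝ (Fin N) → ℝ,
        RadialSystem.IsPositiveRadialSolution N R a b p h u₁ v₁ ∧
          RadialSystem.BlowsUp N R u₁ ∧ RadialSystem.BlowsUp N R v₁) ↔
      (RadialSystem.I₀ p h < ⊤ ∧ RadialSystem.I₁ p h = ⊤)) ∧
    -- (ii) and (iii) for the given solution, when it is not bounded
    (¬ (RadialSystem.BoundedIn N R u ∧ RadialSystem.BoundedIn N R v) →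
      ((RadialSystem.BoundedIn N R u ∧ RadialSystem.BlowsUp N R v) ↔
        RadialSystem.I₁ p h < ⊤) ∧
      ((RadialSystem.BlowsUp N R u ∧ RadialSystem.BlowsUp N R v) ↔
        (RadialSystem.I₀ p h < ⊤ ∧ RadialSystem.I₁ p h = ⊤))) := by
  obtain ⟨n, rfl⟩ : ∃ n, N = n + 1 := ⟨N - 1, by omega⟩
  have D : RadialSystem.Data a b p (RadialSystem.extend h) :=
    RadialSystem.data_extend ha hb hp hC1.continuousOn hmono hpos
  have hI : RadialSystem.I₀ p h ≤ RadialSystem.I₁ p h := by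
    have := RadialSystem.I₀_le_I₁ D
    rwa [RadialSystem.I₀_extend, RadialSystem.I₁_extend] at this
  have hbd := fun {u₁ v₁ : EuclideanSpace ℝ (Fin (n + 1)) → ℝ}
    (hs : RadialSystem.IsPositiveRadialSolution (n + 1) R a b p h u₁ v₁) =>
      hs.boundary_behaviour hR D
  -- The assumed solution supplies the starting profile for the shooting argument.
  have hex := fun hI => huv.exists_blowsUp hR D hC1 hI
  refine ⟨⟨fun hall => ?_, fun htop u₁ v₁ hs => ?_⟩,
    ⟨fun ⟨u₁, v₁, hs, hu, hv⟩ => ?_, fun h₁ => ?_⟩,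
    ⟨fun ⟨u₁, v₁, hs, hu, hv⟩ => ?_, fun ⟨h₀, h₁⟩ => ?_⟩, fun hnot => ?_⟩
  · by_contra hne
    obtain ⟨u₁, v₁, hs, hv⟩ := hex (lt_top_iff_ne_top.2 hne)
    exact (hbd hs).2.1.2 hv (hall u₁ v₁ hs).2
  · obtain ⟨-, hv, hvu, h₀, -, -⟩ := hbd hs
    have hvb : RadialSystem.BoundedIn (n + 1) R v₁ := by
      by_contra hnb
      exact (h₀ (hv.1 hnb)).ne htop
    exact ⟨hvu hvb, hvb⟩
  · exact (hbd hs).2.2.2.2.2 hu hv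
  · obtain ⟨u₁, v₁, hs, hv⟩ := hex (hI.trans_lt h₁)
    exact ⟨u₁, v₁, hs, (hbd hs).2.2.2.2.1 h₁, hv⟩
  · obtain ⟨hu', -, -, h₀, h₁, -⟩ := hbd hs
    exact ⟨h₀ hv, not_lt_top_iff.1 fun hlt => hu'.2 hu (h₁ hlt)⟩
  -- Were u₁ bounded alongside the blow-up of v₁, `I₁` would be finite.
  · obtain ⟨u₁, v₁, hs, hv⟩ := hex h₀
    obtain ⟨hu', -, -, -, -, h₂⟩ := hbd hs
    exact ⟨u₁, v₁, hs, hu'.1 fun hb => (h₂ hb hv).ne h₁, hv⟩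
  · obtain ⟨hu', hv', hvu, h₀, h₁, h₂⟩ := hbd huv
    have hv : RadialSystem.BlowsUp (n + 1) R v := hv'.1 fun hb => hnot ⟨hvu hb, hb⟩
    exact ⟨⟨fun hu => h₂ hu.1 hv, fun hlt => ⟨h₁ hlt, hv⟩⟩,
      ⟨fun hu => ⟨h₀ hv, not_lt_top_iff.1 fun hlt => hu'.2 hu.1 (h₁ hlt)⟩,
        fun hlt => ⟨hu'.1 fun hb => (h₂ hb hv).ne hlt.2, hv⟩⟩⟩
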